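/- Let $\mathsf{RCA}_0$ be the usual system in the two-sorted language of second-order arithmetic ($0,1,+,\cdot,<,=,\in$): the basic axioms of arithmetic, induction for $\Sigma^0_1$ formulas, and comprehension for $\Delta^0_1$ formulas (all with number and set parameters), over classical logic. Inside $\mathsf{RCA}_0$, a set of numbers is *finite* if it is bounded and *infinite* otherwise. * $\mathsf{RCOLOR}_2$. A graph $G=(V,E)$ consists of a set $V$ and a symmetric irreflexive relation $E\subseteq V\times V$. It is *finitely $2$-colorable* if for every finite $V_0\subseteq V$ the induced subgraph has a $2$-coloring, i.e. an $f:V_0\to\{0,1\}$ with $f(x)\ne f(y)$ for all $x,y\in V_0$ with $(x,y)\in E$. A set $H\subseteq V$ is *homogeneous for $G$* if for every finite $V_0\subseteq V$ the induced subgraph has a $2$-coloring that gives color $0$ to every $v\in V_0\cap H$. $\mathsf{RCOLOR}_2$ is the statement: for every infinite, finitely $2$-colorable graph $G=(V,E)$ there is an infinite $H\subseteq V$ that is homogeneous for $G$. * $\mathsf{LRSAT}([x\neq y])$. Let $V$ be an infinite set of Boolean variables and let $C$ be a set of formulas of the form $x\neq y$ with $x,y\in V$ (the case $x=y$, an unsatisfiable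 formula, is allowed syntactically). $C$ is *finitely satisfiable* if for every finite $C_0\subseteq C$ some truth assignment on $V$ satisfies all formulas in $C_0$. A set $H\subseteq V$ is *homogeneous for $C$* if there is a truth value $c$ such that for every finite $C_0\subseteq C$ some truth assignment $\nu$ on $V$ satisfies all formulas in $C_0$ and has $\nu(a)=c$ for all $a\in H$. $\mathsf{LRSAT}([x\neq y])$ is the statement: for every infinite set $V$ of variables, every finitely satisfiable set $C$ of such formulas over $V$, and every infinite set $L\subseteq V$, there is an infinite $H\subseteq L$ that is homogeneous for $C$. **Theorem.** $\mathsf{RCA}_0\vdash \mathsf{RCOLOR}_2\leftrightarrow\mathsf{LRSAT}([x\neq y])$. -/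

import Mathlib

/-! # Second-order arithmetic, the system RCA₀ and two Ramsey-type principles

The language of second-order arithmetic is two-sorted.  Formulas are written with de Bruijn
indices, *separately* for the two sorts: a quantifier over numbers binds number variable `0` of its
body and shifts the other number variables up by one (leaving the set variables alone), and
likewise for quantifiers over sets. -/

namespace SOA

/-- Number terms: variables, `0`, `1`, `+`, `·`. -/
inductive Tm : Type
  | var : ℕ → Tm
  | zero : Tm
  | one : Tm
  | add : Tm → Tm → Tm
  | mul : Tm → Tm → Tm

/-- Formulas.  Atomic formulas are `t = u`, `t < u` and `t ∈ X`, with `X` a set variable. -/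
inductive Fml : Type
  | eq : Tm → Tm → Fml
  | lt : Tm → Tm → Fml
  | mem : Tm → ℕ → Fml
  | bot : Fml
  | imp : Fml → Fml → Fml
  /-- universal quantifier over numbers -/
  | allN : Fml → Fml
  /-- universal quantifier over sets -/
  | allS : Fml → Fml

/-! ### Defined connectives and quantifiers (classical logic) -/

namespace Fml

def neg (φ : Fml) : Fml := imp φ bot
def and (φ ψ : Fml) : Fml := neg (imp φ (neg ψ))
def or (φ ψ : Fml) : Fml := imp (neg φ) ψ
def iff (φ ψ : Fml) : Fml := and (imp φ ψ) (imp ψ φ)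
def exN (φ : Fml) : Fml := neg (allN (neg φ))
def exS (φ : Fml) : Fml := neg (allS (neg φ))

end Fml

prefix:max "♯" => Tm.var
infixl:65 " ∔ " => Tm.add
infixl:70 " ⨰ " => Tm.mul
infix:55 " ≐ " => Fml.eq
infix:55 " ⋖' " => Fml.lt
infix:55 " ∈' " => Fml.mem
prefix:max "∼'" => Fml.neg
infixr:45 " ⋏ " => Fml.and
infixr:44 " ⋎ " => Fml.or
infixr:43 " ➝ " => Fml.imp
infix:42 " ⟷ " => Fml.iff

/-! ### Substitution -/

/-- Simultaneous substitution of `σ i` for the `i`-th number variable. -/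
def Tm.subst (σ : ℕ → Tm) : Tm → Tm
  | .var i => σ i
  | .zero => .zero
  | .one => .one
  | .add t u => .add (t.subst σ) (u.subst σ)
  | .mul t u => .mul (t.subst σ) (u.subst σ)

/-- Raise all number variables of a term by one. -/
def Tm.shift (t : Tm) : Tm := t.subst fun i => ♯(i + 1)

/-- Extend a substitution for numbers under a number quantifier. -/
def upN (σ : ℕ → Tm) : ℕ → Tm
  | 0 => ♯0
  | i + 1 => (σ i).shift

/-- Extend a renaming of set variables under a set quantifier. -/
def upS (ρ : ℕ → ℕ) : ℕ → ℕ
  | 0 => 0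
  | i + 1 => ρ i + 1

/-- Capture-avoiding simultaneous substitution of terms `σ i` for the free number variables and of
set variables `ρ i` for the free set variables. -/
def Fml.subst (σ : ℕ → Tm) (ρ : ℕ → ℕ) : Fml → Fml
  | .eq t u => .eq (t.subst σ) (u.subst σ)
  | .lt t u => .lt (t.subst σ) (u.subst σ)
  | .mem t X => .mem (t.subst σ) (ρ X)
  | .bot => .bot
  | .imp φ ψ => .imp (φ.subst σ ρ) (ψ.subst σ ρ)
  | .allN φ => .allN (φ.subst (upN σ) ρ)
  | .allS φ => .allS (φ.subst σ (upS ρ))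

/-- Raise all free number variables by one. -/
def Fml.shiftN (φ : Fml) : Fml := φ.subst (fun i => ♯(i + 1)) id

/-- Raise all free set variables by one. -/
def Fml.shiftS (φ : Fml) : Fml := φ.subst Tm.var (fun i => i + 1)

/-- `φ(t)`: instantiate number variable `0` by `t` and lower the other number variables. -/
def Fml.instN (φ : Fml) (t : Tm) : Fml :=
  φ.subst (fun i => Nat.casesOn i t Tm.var) id

/-- `φ(X)`: instantiate set variable `0` by the set variable `X` and lower the others. -/
def Fml.instS (φ : Fml) (X : ℕ) : Fml :=
  φ.subst Tm.var (fun i => Nat.casesOn i X id)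

/-- `φ(n + 1)`, where `n` is number variable `0`, which stays free. -/
def Fml.succN (φ : Fml) : Fml :=
  φ.subst (fun i => Nat.casesOn i (♯0 ∔ Tm.one) fun j => ♯(j + 1)) id

/-! ### Provability: classical natural deduction with equality, two-sorted -/

/-- `Prf T Γ φ`: `φ` is derivable from the axioms `T` and the hypotheses `Γ`.  The free variables
of members of `T` are read universally, that is, a member of `T` stands for its universal closure
(so `T` is not shifted in the rules `allN_intro` and `allS_intro`). -/
inductive Prf (T : Set Fml) : List Fml → Fml → Prop
  | ax {Γ : List Fml} {φ : Fml} : φ ∈ T → Prf T Γ φ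
  | hyp {Γ : List Fml} {φ : Fml} : φ ∈ Γ → Prf T Γ φ
  | imp_intro {Γ : List Fml} {φ ψ : Fml} : Prf T (φ :: Γ) ψ → Prf T Γ (φ ➝ ψ)
  | imp_elim {Γ : List Fml} {φ ψ : Fml} : Prf T Γ (φ ➝ ψ) → Prf T Γ φ → Prf T Γ ψ
  | by_contra {Γ : List Fml} {φ : Fml} : Prf T (∼'φ :: Γ) Fml.bot → Prf T Γ φ
  | allN_intro {Γ : List Fml} {φ : Fml} : Prf T (Γ.map Fml.shiftN) φ → Prf T Γ (Fml.allN φ)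
  | allN_elim {Γ : List Fml} {φ : Fml} (t : Tm) : Prf T Γ (Fml.allN φ) → Prf T Γ (φ.instN t)
  | allS_intro {Γ : List Fml} {φ : Fml} : Prf T (Γ.map Fml.shiftS) φ → Prf T Γ (Fml.allS φ)
  | allS_elim {Γ : List Fml} {φ : Fml} (X : ℕ) : Prf T Γ (Fml.allS φ) → Prf T Γ (φ.instS X)
  | eq_refl {Γ : List Fml} (t : Tm) : Prf T Γ (t ≐ t)
  | eq_subst {Γ : List Fml} {t u : Tm} (φ : Fml) :
      Prf T Γ (t ≐ u) → Prf T Γ (φ.instN t) → Prf T Γ (φ.instN u)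

/-- `T ⊢ φ`. -/
def Provable (T : Set Fml) (φ : Fml) : Prop := Prf T [] φ

/-! ### The arithmetical classes and the axioms of RCA₀ -/

/-- Bounded-quantifier (`Δ⁰₀`) formulas, set parameters allowed.  In the quantifier clauses the
bound `t` does not contain the quantified variable. -/
inductive IsDelta00 : Fml → Prop
  | eq (t u : Tm) : IsDelta00 (t ≐ u)
  | lt (t u : Tm) : IsDelta00 (t ⋖' u)
  | mem (t : Tm) (X : ℕ) : IsDelta00 (t ∈' X)
  | bot : IsDelta00 Fml.bot
  | imp {φ ψ : Fml} : IsDelta00 φ → IsDelta00 ψ → IsDelta00 (φ ➝ ψ)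
  | ball (t : Tm) {φ : Fml} : IsDelta00 φ → IsDelta00 (Fml.allN (♯0 ⋖' t.shift ➝ φ))
  | bex (t : Tm) {φ : Fml} : IsDelta00 φ → IsDelta00 (Fml.exN (♯0 ⋖' t.shift ⋏ φ))

/-- `Σ⁰₁` formulas: `∃ m θ` with `θ` bounded-quantifier. -/
inductive IsSigma01 : Fml → Prop
  | ex {θ : Fml} : IsDelta00 θ → IsSigma01 (Fml.exN θ)

/-- `Π⁰₁` formulas: `∀ m θ` with `θ` bounded-quantifier. -/
inductive IsPi01 : Fml → Prop
  | all {θ : Fml} : IsDelta00 θ → IsPi01 (Fml.allN θ)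

/-- The axioms of `RCA₀`: the basic axioms of arithmetic, induction for `Σ⁰₁` formulas and
comprehension for `Δ⁰₁` formulas, all with arbitrary number and set parameters. -/
inductive RCA0 : Set Fml
  | succ_ne_zero : RCA0 (∼'(♯0 ∔ Tm.one ≐ Tm.zero))
  | succ_inj : RCA0 (♯0 ∔ Tm.one ≐ ♯1 ∔ Tm.one ➝ ♯0 ≐ ♯1)
  | add_zero : RCA0 (♯0 ∔ Tm.zero ≐ ♯0)
  | add_succ : RCA0 (♯0 ∔ (♯1 ∔ Tm.one) ≐ (♯0 ∔ ♯1) ∔ Tm.one)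
  | mul_zero : RCA0 (♯0 ⨰ Tm.zero ≐ Tm.zero)
  | mul_succ : RCA0 (♯0 ⨰ (♯1 ∔ Tm.one) ≐ (♯0 ⨰ ♯1) ∔ ♯0)
  | not_lt_zero : RCA0 (∼'(♯0 ⋖' Tm.zero))
  | lt_succ : RCA0 (♯0 ⋖' ♯1 ∔ Tm.one ⟷ ♯0 ⋖' ♯1 ⋎ ♯0 ≐ ♯1)
  /-- `φ(0) ∧ ∀ n (φ(n) → φ(n + 1)) → ∀ n φ(n)` for `φ` in `Σ⁰₁` -/
  | induction {φ : Fml} : IsSigma01 φ →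
      RCA0 (φ.instN Tm.zero ⋏ Fml.allN (φ ➝ φ.succN) ➝ Fml.allN φ)
  /-- `∀ n (φ(n) ↔ ψ(n)) → ∃ X ∀ n (n ∈ X ↔ φ(n))` for `φ` in `Σ⁰₁`, `ψ` in `Π⁰₁`, and `X` not
  free in `φ` -/
  | comprehension {φ ψ : Fml} : IsSigma01 φ → IsPi01 ψ →
      RCA0 (Fml.allN (φ ⟷ ψ) ➝ Fml.exS (Fml.allN (♯0 ∈' 0 ⟷ φ.shiftS)))

/-! ### Basic notions, as formulas

Arguments `V E C F H X Y ...` below are set variables (indices). Under a set quantifier they are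
raised by one, the newly bound set being `0`. -/

/-- The code `(t + u)² + t` of the ordered pair `(t, u)`. -/
def pair (t u : Tm) : Tm := (t ∔ u) ⨰ (t ∔ u) ∔ t

/-- `X` is finite: `∃ b ∀ x (x ∈ X → x < b)`. -/
def finite (X : ℕ) : Fml := .exN (.allN (♯0 ∈' X ➝ ♯0 ⋖' ♯1))

/-- `X` is infinite. -/
def infinite (X : ℕ) : Fml := ∼'(finite X)

/-- `X ⊆ Y`. -/
def subset (X Y : ℕ) : Fml := .allN (♯0 ∈' X ➝ ♯0 ∈' Y)

/-- `E ⊆ V × V`: every element of `E` is the code of a pair of elements of `V`. -/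
def relOn (V E : ℕ) : Fml :=
  .allN (♯0 ∈' E ➝ .exN (.exN (♯1 ∈' V ⋏ ♯0 ∈' V ⋏ ♯2 ≐ pair ♯1 ♯0)))

/-! ### The principle `RCOLOR₂` -/

/-- `(V, E)` is a (simple, undirected) graph; `E` is a symmetric irreflexive relation on `V`. -/
def isGraph (V E : ℕ) : Fml :=
  relOn V E
    ⋏ .allN (.allN (pair ♯1 ♯0 ∈' E ➝ pair ♯0 ♯1 ∈' E))
    ⋏ .allN (∼'(pair ♯0 ♯0 ∈' E))

/-- `F` is a 2-coloring of the subgraph of `(V, E)` induced by `V₀`.  A map to `{0, 1}` is given by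
the set `F` of the points it sends to `1`: `x` has color `1` if `x ∈ F` and color `0` if `x ∉ F`. -/
def coloring (V₀ E F : ℕ) : Fml :=
  .allN (.allN (♯1 ∈' V₀ ⋏ ♯0 ∈' V₀ ⋏ pair ♯1 ♯0 ∈' E ➝ ∼'(♯1 ∈' F ⟷ ♯0 ∈' F)))

/-- `(V, E)` is finitely 2-colorable: for every finite `V₀ ⊆ V` the subgraph induced by `V₀` has a
2-coloring `F`. -/
def finitelyColorable (V E : ℕ) : Fml :=
  .allS (finite 0 ⋏ subset 0 (V + 1) ➝ .exS (coloring 1 (E + 2) 0))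

/-- `H` is homogeneous for the graph `(V, E)`: for every finite `V₀ ⊆ V` the subgraph induced by
`V₀` has a 2-coloring `F` that gives color `0` to every `v ∈ V₀ ∩ H`. -/
def homogeneousGraph (V E H : ℕ) : Fml :=
  .allS (finite 0 ⋏ subset 0 (V + 1) ➝
    .exS (coloring 1 (E + 2) 0 ⋏ .allN (♯0 ∈' 1 ⋏ ♯0 ∈' (H + 2) ➝ ∼'(♯0 ∈' 0))))

/-- `RCOLOR₂`: for every infinite, finitely 2-colorable graph `(V, E)` there is an infinite
`H ⊆ V` that is homogeneous for it. (Outside `∃ H`, `V` is `1` and `E` is `0`; inside, `V` is `2`,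
`E` is `1` and `H` is `0`.) -/
def RCOLOR2 : Fml :=
  .allS (.allS (isGraph 1 0 ⋏ infinite 1 ⋏ finitelyColorable 1 0 ➝
    .exS (subset 0 2 ⋏ infinite 0 ⋏ homogeneousGraph 2 1 0)))

/-! ### The principle `LRSAT([x ≠ y])`

The relation `[x ≠ y]` is `R = {(0, 1), (1, 0)}`. A formula `R(x, y)` with variables `x, y ∈ V`
(not necessarily distinct) is coded by the pair `(x, y)`; so a set of such formulas over `V` is a
set `C ⊆ V × V`. -/

/-- The assignment `F` (`x` is true if `x ∈ F`, false if `x ∉ F`) satisfies every formula `R(x, y)`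
in `C₀`. -/
def satisfies (F C₀ : ℕ) : Fml :=
  .allN (.allN (pair ♯1 ♯0 ∈' C₀ ➝ ∼'(♯1 ∈' F ⟷ ♯0 ∈' F)))

/-- `C` is finitely satisfiable: every finite `C₀ ⊆ C` is satisfied by some assignment `F`. -/
def finitelySatisfiable (C : ℕ) : Fml :=
  .allS (finite 0 ⋏ subset 0 (C + 1) ➝ .exS (satisfies 0 1))

/-- `H` is homogeneous for `C`: there is a truth value `c` (true in the first disjunct, false in
the second) such that every finite `C₀ ⊆ C` is satisfied by an assignment `F` with value `c` on
all of `H`. -/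
def homogeneousFml (C H : ℕ) : Fml :=
  .allS (finite 0 ⋏ subset 0 (C + 1) ➝
      .exS (satisfies 0 1 ⋏ .allN (♯0 ∈' (H + 2) ➝ ♯0 ∈' 0)))
    ⋎ .allS (finite 0 ⋏ subset 0 (C + 1) ➝
      .exS (satisfies 0 1 ⋏ .allN (♯0 ∈' (H + 2) ➝ ∼'(♯0 ∈' 0))))

/-- `LRSAT([x ≠ y])`: for every infinite set `V` of variables, every finitely satisfiable set `C`
of formulas `R(x, y)` over `V` and every infinite `L ⊆ V` there is an infinite `H ⊆ L` that is
homogeneous for `C`. (Indices: first `V` is `1`, `C` is `0`; inside `∀ L`, `V` is `2`, `C` is `1`,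
`L` is `0`; inside `∃ H`, `C` is `2`, `L` is `1`, `H` is `0`.) -/
def LRSATneq : Fml :=
  .allS (.allS (infinite 1 ⋏ relOn 1 0 ⋏ finitelySatisfiable 0 ➝
    .allS (subset 0 2 ⋏ infinite 0 ➝
      .exS (subset 0 1 ⋏ infinite 0 ⋏ homogeneousFml 2 0))))

end SOA

namespace SOA

/-! ### Substitution calculus -/

/-- `a` followed by `f`. -/
def scons {α : Type} (a : α) (f : ℕ → α) : ℕ → α
  | 0 => a
  | i + 1 => f i

theorem Tm.subst_subst (σ τ : ℕ → Tm) (t : Tm) :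
    (t.subst σ).subst τ = t.subst fun i => (σ i).subst τ := by
  induction t <;> simp_all [Tm.subst]

theorem Tm.subst_var (t : Tm) : t.subst Tm.var = t := by
  induction t <;> simp_all [Tm.subst]

theorem Tm.shift_subst_scons (t u : Tm) (σ : ℕ → Tm) :
    t.shift.subst (scons u σ) = t.subst σ := by
  rw [Tm.shift, Tm.subst_subst]; rfl

theorem Tm.shift_subst_upN (t : Tm) (σ : ℕ → Tm) :
    t.shift.subst (upN σ) = (t.subst σ).shift := by
  rw [Tm.shift, Tm.shift, Tm.subst_subst, Tm.subst_subst]; rfl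

theorem upN_var : upN Tm.var = Tm.var := by
  funext i; cases i <;> rfl

theorem upS_id : upS id = id := by
  funext i; cases i <;> rfl

theorem upS_comp (ρ ρ' : ℕ → ℕ) : upS ρ' ∘ upS ρ = upS (ρ' ∘ ρ) := by
  funext i; cases i <;> rfl

theorem upN_subst_upN (σ τ : ℕ → Tm) :
    (fun i => (upN σ i).subst (upN τ)) = upN fun i => (σ i).subst τ := by
  funext i
  cases i with
  | zero => rfl
  | succ i => exact Tm.shift_subst_upN _ _

theorem Fml.subst_subst (φ : Fml) : ∀ (σ τ : ℕ → Tm) (ρ ρ' : ℕ → ℕ),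
    (φ.subst σ ρ).subst τ ρ' = φ.subst (fun i => (σ i).subst τ) (ρ' ∘ ρ) := by
  induction φ <;> intro σ τ ρ ρ' <;>
    simp_all [Fml.subst, Tm.subst_subst, upN_subst_upN, upS_comp]

theorem Fml.subst_var (φ : Fml) : φ.subst Tm.var id = φ := by
  induction φ <;> simp_all [Fml.subst, Tm.subst_var, upN_var, upS_id]

theorem Tm.exists_subst_congr (t : Tm) : ∃ n, ∀ σ τ : ℕ → Tm, (∀ i < n, σ i = τ i) →
    t.subst σ = t.subst τ := by
  induction t with
  | var i => exact ⟨i + 1, fun σ τ h => h i (by omega)⟩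
  | zero => exact ⟨0, fun _ _ _ => rfl⟩
  | one => exact ⟨0, fun _ _ _ => rfl⟩
  | add t u iht ihu | mul t u iht ihu =>
    obtain ⟨n, hn⟩ := iht
    obtain ⟨m, hm⟩ := ihu
    refine ⟨max n m, fun σ τ h => ?_⟩
    simp only [Tm.subst]
    rw [hn σ τ fun i hi => h i (by omega), hm σ τ fun i hi => h i (by omega)]

/-- Only finitely many variables matter for a substitution into a formula. -/
theorem Fml.exists_subst_congr (φ : Fml) : ∃ n, ∀ (σ τ : ℕ → Tm) (ρ ρ' : ℕ → ℕ),
    (∀ i < n, σ i = τ i) → (∀ i < n, ρ i = ρ' i) → φ.subst σ ρ = φ.subst τ ρ' := by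
  induction φ with
  | eq t u | lt t u =>
    obtain ⟨n, hn⟩ := t.exists_subst_congr
    obtain ⟨m, hm⟩ := u.exists_subst_congr
    refine ⟨max n m, fun σ τ ρ ρ' h _ => ?_⟩
    simp only [Fml.subst]
    rw [hn σ τ fun i hi => h i (by omega), hm σ τ fun i hi => h i (by omega)]
  | mem t X =>
    obtain ⟨n, hn⟩ := t.exists_subst_congr
    refine ⟨max n (X + 1), fun σ τ ρ ρ' h h' => ?_⟩
    simp only [Fml.subst]
    rw [hn σ τ fun i hi => h i (by omega), h' X (by omega)]
  | bot => exact ⟨0, fun _ _ _ _ _ _ => rfl⟩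
  | imp φ ψ ihφ ihψ =>
    obtain ⟨n, hn⟩ := ihφ
    obtain ⟨m, hm⟩ := ihψ
    refine ⟨max n m, fun σ τ ρ ρ' h h' => ?_⟩
    simp only [Fml.subst]
    rw [hn σ τ ρ ρ' (fun i hi => h i (by omega)) fun i hi => h' i (by omega),
      hm σ τ ρ ρ' (fun i hi => h i (by omega)) fun i hi => h' i (by omega)]
  | allN φ ih =>
    obtain ⟨n, hn⟩ := ih
    refine ⟨n, fun σ τ ρ ρ' h h' => ?_⟩
    simp only [Fml.subst]
    rw [hn (upN σ) (upN τ) ρ ρ' ?_ h']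
    rintro (_ | i) hi
    · rfl
    · simp only [upN, h i (by omega)]
  | allS φ ih =>
    obtain ⟨n, hn⟩ := ih
    refine ⟨n, fun σ τ ρ ρ' h h' => ?_⟩
    simp only [Fml.subst]
    rw [hn σ τ (upS ρ) (upS ρ') h ?_]
    rintro (_ | i) hi
    · rfl
    · simp only [upS, h' i (by omega)]

theorem Fml.instN_eq (φ : Fml) (t : Tm) : φ.instN t = φ.subst (scons t Tm.var) id := by
  rw [Fml.instN]; congr 1; funext i; cases i <;> rfl

theorem Fml.instS_eq (φ : Fml) (X : ℕ) : φ.instS X = φ.subst Tm.var (scons X id) := by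
  rw [Fml.instS]; congr 1; funext i; cases i <;> rfl

theorem Fml.subst_upN_instN (φ : Fml) (σ : ℕ → Tm) (ρ : ℕ → ℕ) (t : Tm) :
    (φ.subst (upN σ) ρ).instN t = φ.subst (scons t σ) ρ := by
  rw [Fml.instN_eq, Fml.subst_subst]
  congr 1
  funext i
  cases i with
  | zero => rfl
  | succ i => exact (Tm.shift_subst_scons _ _ _).trans (Tm.subst_var _)

theorem Fml.subst_upS_instS (φ : Fml) (σ : ℕ → Tm) (ρ : ℕ → ℕ) (X : ℕ) :
    (φ.subst σ (upS ρ)).instS X = φ.subst σ (scons X ρ) := by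
  rw [Fml.instS_eq, Fml.subst_subst]
  congr 1
  · funext i; exact Tm.subst_var _
  · funext i; cases i <;> rfl

/-! ### Derived rules -/

namespace Prf

variable {T : Set Fml} {Γ Δ : List Fml} {φ ψ : Fml}

theorem mono (h : Prf T Γ φ) : ∀ {Δ : List Fml}, Γ ⊆ Δ → Prf T Δ φ := by
  induction h with
  | ax h => exact fun _ => .ax h
  | hyp h => exact fun hs => .hyp (hs h)
  | imp_intro _ ih => exact fun hs => .imp_intro (ih (List.cons_subset_cons _ hs))
  | imp_elim _ _ ih ih' => exact fun hs => .imp_elim (ih hs) (ih' hs)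
  | by_contra _ ih => exact fun hs => .by_contra (ih (List.cons_subset_cons _ hs))
  | allN_intro _ ih => exact fun hs => .allN_intro (ih (List.map_subset _ hs))
  | allN_elim t _ ih => exact fun hs => .allN_elim t (ih hs)
  | allS_intro _ ih => exact fun hs => .allS_intro (ih (List.map_subset _ hs))
  | allS_elim X _ ih => exact fun hs => .allS_elim X (ih hs)
  | eq_refl t => exact fun _ => .eq_refl t
  | eq_subst φ _ _ ih ih' => exact fun hs => .eq_subst φ (ih hs) (ih' hs)

theorem weaken (h : Prf T Γ φ) : Prf T (ψ :: Γ) φ := h.mono (List.subset_cons_self _ _)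

theorem exfalso (h : Prf T Γ Fml.bot) : Prf T Γ φ := .by_contra h.weaken

theorem cut (h : Prf T Γ φ) (h' : Prf T (φ :: Γ) ψ) : Prf T Γ ψ := .imp_elim (.imp_intro h') h

/-- The hypotheses of a derivation can be moved to the conclusion. -/
theorem foldl_imp (Γ : List Fml) : ∀ φ, Prf T Γ φ ↔ Prf T [] (Γ.foldl (fun χ γ => γ ➝ χ) φ) := by
  induction Γ with
  | nil => exact fun _ => Iff.rfl
  | cons γ Γ ih =>
    intro φ
    rw [List.foldl_cons, ← ih]
    exact ⟨.imp_intro, fun h => .imp_elim h.weaken (.hyp List.mem_cons_self)⟩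

end Prf

theorem Fml.subst_foldl_imp (σ : ℕ → Tm) (ρ : ℕ → ℕ) (Γ : List Fml) : ∀ φ : Fml,
    (Γ.foldl (fun χ γ => γ ➝ χ) φ).subst σ ρ =
      (Γ.map (·.subst σ ρ)).foldl (fun χ γ => γ ➝ χ) (φ.subst σ ρ) := by
  induction Γ with
  | nil => exact fun _ => rfl
  | cons γ Γ ih =>
    intro φ
    rw [List.foldl_cons, ih, List.map_cons, List.foldl_cons]; rfl

/-! ### Derivability is closed under substitution -/

theorem Fml.subst_iterate_upN (φ : Fml) (n : ℕ) : ∀ (σ : ℕ → Tm) (ρ : ℕ → ℕ),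
    (Fml.allN^[n] φ).subst σ ρ = Fml.allN^[n] (φ.subst (upN^[n] σ) ρ) := by
  induction n with
  | zero => exact fun _ _ => rfl
  | succ n ih =>
    intro σ ρ
    rw [Function.iterate_succ_apply', Function.iterate_succ_apply', Function.iterate_succ_apply,
      Fml.subst, ih]

theorem Fml.subst_iterate_upS (φ : Fml) (n : ℕ) : ∀ (σ : ℕ → Tm) (ρ : ℕ → ℕ),
    (Fml.allS^[n] φ).subst σ ρ = Fml.allS^[n] (φ.subst σ (upS^[n] ρ)) := by
  induction n with
  | zero => exact fun _ _ => rfl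
  | succ n ih =>
    intro σ ρ
    rw [Function.iterate_succ_apply', Function.iterate_succ_apply', Function.iterate_succ_apply,
      Fml.subst, ih]

theorem iterate_upN_of_lt (σ : ℕ → Tm) (n : ℕ) : ∀ i < n, upN^[n] σ i = ♯i := by
  induction n with
  | zero => exact fun i hi => absurd hi (Nat.not_lt_zero i)
  | succ n ih =>
    intro i hi
    rw [Function.iterate_succ_apply']
    cases i with
    | zero => rfl
    | succ i => rw [upN, ih i (by omega)]; rfl

theorem iterate_upS_of_lt (ρ : ℕ → ℕ) (n : ℕ) : ∀ i < n, upS^[n] ρ i = i := by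
  induction n with
  | zero => exact fun i hi => absurd hi (Nat.not_lt_zero i)
  | succ n ih =>
    intro i hi
    rw [Function.iterate_succ_apply']
    cases i with
    | zero => rfl
    | succ i => rw [upS, ih i (by omega)]

namespace Prf

variable {T : Set Fml} {Γ : List Fml} {φ : Fml}

theorem substN (h : Prf T [] φ) (σ : ℕ → Tm) : Prf T [] (φ.subst σ id) := by
  obtain ⟨n, hn⟩ := φ.exists_subst_congr
  have hall : ∀ k, Prf T [] (Fml.allN^[k] φ) := by
    intro k
    induction k with
    | zero => exact h
    | succ k ih => rw [Function.iterate_succ_apply']; exact .allN_intro ih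
  have key : ∀ j k, j + k = n → Prf T [] ((Fml.allN^[k] φ).subst (fun i => σ (i + k)) id) := by
    intro j
    induction j with
    | zero =>
      intro k hk
      rw [Fml.subst_iterate_upN, hn _ Tm.var _ id (fun i hi => iterate_upN_of_lt _ _ i (by omega))
        (fun _ _ => rfl), Fml.subst_var]
      exact hall k
    | succ j ih =>
      intro k hk
      have := allN_elim (σ k) (by
        have := ih (k + 1) (by omega)
        rwa [Function.iterate_succ_apply', Fml.subst] at this)
      rw [Fml.subst_upN_instN] at this
      convert this using 2
      funext i
      cases i with
      | zero => simp [scons]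
      | succ i => simp only [scons]; congr 1; omega
  simpa using key n 0 (by omega)

theorem substS (h : Prf T [] φ) (ρ : ℕ → ℕ) : Prf T [] (φ.subst Tm.var ρ) := by
  obtain ⟨n, hn⟩ := φ.exists_subst_congr
  have hall : ∀ k, Prf T [] (Fml.allS^[k] φ) := by
    intro k
    induction k with
    | zero => exact h
    | succ k ih => rw [Function.iterate_succ_apply']; exact .allS_intro ih
  have key : ∀ j k, j + k = n → Prf T [] ((Fml.allS^[k] φ).subst Tm.var (fun i => ρ (i + k))) := by
    intro j
    induction j with
    | zero =>
      intro k hk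
      rw [Fml.subst_iterate_upS, hn _ Tm.var _ id (fun _ _ => rfl)
        (fun i hi => iterate_upS_of_lt _ _ i (by omega)), Fml.subst_var]
      exact hall k
    | succ j ih =>
      intro k hk
      have := allS_elim (ρ k) (by
        have := ih (k + 1) (by omega)
        rwa [Function.iterate_succ_apply', Fml.subst] at this)
      rw [Fml.subst_upS_instS] at this
      convert this using 2
      funext i
      cases i with
      | zero => simp [scons]
      | succ i => simp only [scons]; congr 1; omega
  simpa using key n 0 (by omega)

theorem subst (h : Prf T Γ φ) (σ : ℕ → Tm) (ρ : ℕ → ℕ) :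
    Prf T (Γ.map (·.subst σ ρ)) (φ.subst σ ρ) := by
  rw [foldl_imp] at h ⊢
  rw [← Fml.subst_foldl_imp]
  have := (h.substN σ).substS ρ
  rwa [Fml.subst_subst, show (fun i => (σ i).subst Tm.var) = σ from
    funext fun i => Tm.subst_var _, Function.comp_id] at this

end Prf

theorem exists_subst_congr_list (Γ : List Fml) : ∃ n, ∀ φ ∈ Γ, ∀ (σ τ : ℕ → Tm) (ρ ρ' : ℕ → ℕ),
    (∀ i < n, σ i = τ i) → (∀ i < n, ρ i = ρ' i) → φ.subst σ ρ = φ.subst τ ρ' := by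
  induction Γ with
  | nil => exact ⟨0, by simp⟩
  | cons φ Γ ih =>
    obtain ⟨n, hn⟩ := φ.exists_subst_congr
    obtain ⟨m, hm⟩ := ih
    refine ⟨max n m, fun ψ hψ σ τ ρ ρ' h h' => ?_⟩
    rcases List.mem_cons.1 hψ with rfl | hψ
    · exact hn σ τ ρ ρ' (fun i hi => h i (by omega)) fun i hi => h' i (by omega)
    · exact hm ψ hψ σ τ ρ ρ' (fun i hi => h i (by omega)) fun i hi => h' i (by omega)

namespace Prf

variable {T : Set Fml}

/-- Generalization on a fresh number variable. -/
theorem exists_fresh_allN (Γ : List Fml) (φ : Fml) :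
    ∃ k, Prf T Γ (φ.instN ♯k) → Prf T Γ (Fml.allN φ) := by
  obtain ⟨n, hn⟩ := exists_subst_congr_list (φ :: Γ)
  refine ⟨n, fun h => .allN_intro ?_⟩
  have := h.subst (fun i => if i = n then ♯0 else ♯(i + 1)) id
  rw [Fml.instN_eq, Fml.subst_subst] at this
  convert this using 1
  · refine List.map_congr_left fun ψ hψ => ?_
    refine hn ψ (List.mem_cons_of_mem _ hψ) _ _ _ _ (fun i hi => ?_) fun _ _ => rfl
    rw [if_neg (by omega)]
  · conv_lhs => rw [← φ.subst_var]
    refine hn φ List.mem_cons_self _ _ _ _ (fun i hi => ?_) fun _ _ => rfl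
    cases i with
    | zero => simp [scons, Tm.subst]
    | succ i => simp only [scons, Tm.subst]; rw [if_neg (by omega)]

/-- Generalization on a fresh set variable. -/
theorem exists_fresh_allS (Γ : List Fml) (φ : Fml) :
    ∃ k, Prf T Γ (φ.instS k) → Prf T Γ (Fml.allS φ) := by
  obtain ⟨n, hn⟩ := exists_subst_congr_list (φ :: Γ)
  refine ⟨n, fun h => .allS_intro ?_⟩
  have := h.subst Tm.var (fun i => if i = n then 0 else i + 1)
  rw [Fml.instS_eq, Fml.subst_subst] at this
  convert this using 1
  · refine List.map_congr_left fun ψ hψ => ?_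
    refine hn ψ (List.mem_cons_of_mem _ hψ) _ _ _ _ (fun _ _ => rfl) fun i hi => ?_
    rw [if_neg (by omega)]
  · conv_lhs => rw [← φ.subst_var]
    refine hn φ List.mem_cons_self _ _ _ _ (fun _ _ => rfl) fun i hi => ?_
    cases i with
    | zero => simp [scons]
    | succ i => exact (if_neg (by omega : ¬i = n)).symm

end Prf
end SOA

namespace SOA

/-! ### Semantics -/

/-- A structure for the language of second-order arithmetic. -/
structure Str : Type 1 where
  /-- numbers -/
  N : Type
  /-- sets -/
  S : Type
  nonempty : Nonempty S
  zero : N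
  one : N
  add : N → N → N
  mul : N → N → N
  lt : N → N → Prop
  mem : N → S → Prop

variable {M : Str}

/-- The value of a term. -/
def Tm.eval (e : ℕ → M.N) : Tm → M.N
  | .var i => e i
  | .zero => M.zero
  | .one => M.one
  | .add t u => M.add (t.eval e) (u.eval e)
  | .mul t u => M.mul (t.eval e) (u.eval e)

/-- Satisfaction. -/
def Fml.sat : Fml → (ℕ → M.N) → (ℕ → M.S) → Prop
  | .eq t u, e, _ => t.eval e = u.eval e
  | .lt t u, e, _ => M.lt (t.eval e) (u.eval e)
  | .mem t X, e, s => M.mem (t.eval e) (s X)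
  | .bot, _, _ => False
  | .imp φ ψ, e, s => φ.sat e s → ψ.sat e s
  | .allN φ, e, s => ∀ a, φ.sat (scons a e) s
  | .allS φ, e, s => ∀ X, φ.sat e (scons X s)

theorem Tm.eval_subst (σ : ℕ → Tm) (e : ℕ → M.N) (t : Tm) :
    (t.subst σ).eval e = t.eval fun i => (σ i).eval e := by
  induction t <;> simp_all [Tm.subst, Tm.eval]

theorem Tm.eval_shift (t : Tm) (a : M.N) (e : ℕ → M.N) : t.shift.eval (scons a e) = t.eval e := by
  rw [Tm.shift, Tm.eval_subst]; rfl

theorem Fml.sat_subst (φ : Fml) : ∀ (σ : ℕ → Tm) (ρ : ℕ → ℕ) (e : ℕ → M.N) (s : ℕ → M.S),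
    (φ.subst σ ρ).sat e s ↔ φ.sat (fun i => (σ i).eval e) (fun i => s (ρ i)) := by
  induction φ with
  | eq t u | lt t u | mem t X => intro σ ρ e s; simp [Fml.subst, Fml.sat, Tm.eval_subst]
  | bot => exact fun _ _ _ _ => Iff.rfl
  | imp φ ψ ihφ ihψ => intro σ ρ e s; exact imp_congr (ihφ ..) (ihψ ..)
  | allN φ ih =>
    intro σ ρ e s
    refine forall_congr' fun a => (ih ..).trans (iff_of_eq ?_)
    congr 1
    funext i
    cases i with
    | zero => rfl
    | succ i => exact Tm.eval_shift _ _ _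
  | allS φ ih =>
    intro σ ρ e s
    refine forall_congr' fun a => (ih ..).trans (iff_of_eq ?_)
    congr 1
    funext i
    cases i <;> rfl

/-! ### Countability of the language -/

/-- A Gödel numbering of terms. -/
def Tm.code : Tm → ℕ
  | .var i => Nat.pair 0 i
  | .zero => Nat.pair 1 0
  | .one => Nat.pair 2 0
  | .add t u => Nat.pair 3 (Nat.pair t.code u.code)
  | .mul t u => Nat.pair 4 (Nat.pair t.code u.code)

theorem Tm.code_injective : Function.Injective Tm.code := by
  intro t
  induction t with
  | var i | zero | one => intro u h; cases u <;> simp_all [Tm.code, Nat.pair_eq_pair]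
  | add t t' ih ih' | mul t t' ih ih' =>
    intro u h
    cases u <;> simp [Tm.code, Nat.pair_eq_pair] at h
    case _ u u' => rw [ih h.1, ih' h.2]

/-- A Gödel numbering of formulas. -/
def Fml.code : Fml → ℕ
  | .eq t u => Nat.pair 0 (Nat.pair t.code u.code)
  | .lt t u => Nat.pair 1 (Nat.pair t.code u.code)
  | .mem t X => Nat.pair 2 (Nat.pair t.code X)
  | .bot => Nat.pair 3 0
  | .imp φ ψ => Nat.pair 4 (Nat.pair φ.code ψ.code)
  | .allN φ => Nat.pair 5 φ.code
  | .allS φ => Nat.pair 6 φ.code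

theorem Fml.code_injective : Function.Injective Fml.code := by
  intro φ
  induction φ with
  | eq t u | lt t u | mem t X | bot =>
    intro ψ h
    cases ψ <;> simp_all [Fml.code, Nat.pair_eq_pair, Tm.code_injective.eq_iff]
  | imp φ φ' ih ih' =>
    intro ψ h
    cases ψ <;> simp [Fml.code, Nat.pair_eq_pair] at h
    case _ ψ ψ' => rw [ih h.1, ih' h.2]
  | allN φ ih | allS φ ih =>
    intro ψ h
    cases ψ <;> simp [Fml.code, Nat.pair_eq_pair] at h
    case _ ψ => rw [ih h]

instance : Countable Fml := Fml.code_injective.countable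

instance : Nonempty Fml := ⟨Fml.bot⟩

/-! ### Henkin theories -/

/-- A deductively closed, complete and consistent set of formulas with witnesses. -/
structure Henkin (T : Set Fml) where
  /-- the theorems -/
  Th : Fml → Prop
  of_prf : ∀ {φ}, Prf T [] φ → Th φ
  mp : ∀ {φ ψ}, Th (φ ➝ ψ) → Th φ → Th ψ
  not_bot : ¬Th Fml.bot
  complete : ∀ φ, Th φ ∨ Th (∼'φ)
  allN : ∀ {φ : Fml}, (∀ t, Th (φ.instN t)) → Th (Fml.allN φ)
  allS : ∀ {φ : Fml}, (∀ X, Th (φ.instS X)) → Th (Fml.allS φ)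

variable {T : Set Fml}

theorem exists_henkin_step (Γ : List Fml) (φ : Fml) (h : ¬Prf T Γ Fml.bot) :
    ∃ Δ, Γ ⊆ Δ ∧ ¬Prf T Δ Fml.bot ∧ (φ ∈ Δ ∨ ∼'φ ∈ Δ ∧
      (∀ ψ, φ = Fml.allN ψ → ∃ t, ∼'(ψ.instN t) ∈ Δ) ∧
      ∀ ψ, φ = Fml.allS ψ → ∃ X, ∼'(ψ.instS X) ∈ Δ) := by
  by_cases hφ : Prf T (φ :: Γ) Fml.bot
  · have hn : Prf T Γ (∼'φ) := .imp_intro hφ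
    have hc : ∀ χ, (Prf T Γ χ → Prf T Γ φ) → ¬Prf T (∼'χ :: ∼'φ :: Γ) Fml.bot := fun χ hχ h' =>
      h (.imp_elim hn (hχ (.cut hn (.by_contra h') )))
    by_cases hN : ∃ ψ, φ = Fml.allN ψ
    · obtain ⟨ψ, rfl⟩ := hN
      obtain ⟨k, hk⟩ := Prf.exists_fresh_allN (T := T) Γ ψ
      exact ⟨_, fun _ h => by simp [h], hc _ hk, .inr ⟨by simp,
        fun ψ' h => ⟨♯k, by cases h; simp⟩, fun ψ' h => by cases h⟩⟩
    by_cases hS : ∃ ψ, φ = Fml.allS ψ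
    · obtain ⟨ψ, rfl⟩ := hS
      obtain ⟨k, hk⟩ := Prf.exists_fresh_allS (T := T) Γ ψ
      exact ⟨_, fun _ h => by simp [h], hc _ hk, .inr ⟨by simp,
        fun ψ' h => (by cases h), fun ψ' h => ⟨k, by cases h; simp⟩⟩⟩
    exact ⟨∼'φ :: Γ, List.subset_cons_self _ _, fun h' => h (.cut hn h'), .inr ⟨by simp,
      fun ψ h => (hN ⟨ψ, h⟩).elim, fun ψ h => (hS ⟨ψ, h⟩).elim⟩⟩
  · exact ⟨φ :: Γ, List.subset_cons_self _ _, hφ, .inl List.mem_cons_self⟩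

/-- Lindenbaum's lemma with Henkin witnesses. -/
theorem exists_henkin {φ : Fml} (h : ¬Prf T [] φ) : ∃ H : Henkin T, ¬H.Th φ := by
  obtain ⟨f, hf⟩ := exists_surjective_nat Fml
  choose g hg using fun (Γ : {Γ : List Fml // ¬Prf T Γ Fml.bot}) (φ : Fml) =>
    exists_henkin_step Γ.1 φ Γ.2
  let G : ℕ → {Γ : List Fml // ¬Prf T Γ Fml.bot} := fun n => Nat.rec
    ⟨[∼'φ], fun h' => h (.by_contra h')⟩ (fun n Γ => ⟨g Γ (f n), (hg Γ (f n)).2.1⟩) n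
  have hG : ∀ n, G (n + 1) = ⟨g (G n) (f n), (hg (G n) (f n)).2.1⟩ := fun n => rfl
  have hmono : ∀ {m n}, m ≤ n → (G m).1 ⊆ (G n).1 := by
    intro m n hmn
    induction hmn with
    | refl => exact fun _ h => h
    | step _ ih => exact fun _ h => by rw [hG]; exact (hg _ _).1 (ih h)
  have hstep : ∀ φ, ∃ n, φ ∈ (G n).1 ∨ ∼'φ ∈ (G n).1 ∧
      (∀ ψ, φ = Fml.allN ψ → ∃ t, ∼'(ψ.instN t) ∈ (G n).1) ∧
      ∀ ψ, φ = Fml.allS ψ → ∃ X, ∼'(ψ.instS X) ∈ (G n).1 := by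
    intro φ
    obtain ⟨n, rfl⟩ := hf φ
    exact ⟨n + 1, (hg (G n) (f n)).2.2⟩
  have hcons : ∀ ψ, (∃ n, Prf T (G n).1 ψ) → ¬∃ n, Prf T (G n).1 (∼'ψ) := by
    rintro ψ ⟨m, hm⟩ ⟨n, hn⟩
    exact (G (max m n)).2 (.imp_elim (hn.mono (hmono (le_max_right _ _)))
      (hm.mono (hmono (le_max_left _ _))))
  refine ⟨⟨fun ψ => ∃ n, Prf T (G n).1 ψ, fun hψ => ⟨0, hψ.mono (List.nil_subset _)⟩, ?_,
    fun ⟨n, hn⟩ => (G n).2 hn, fun ψ => ?_, fun {ψ} hψ => ?_, fun {ψ} hψ => ?_⟩, fun hφ => ?_⟩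
  · rintro ψ χ ⟨m, hm⟩ ⟨n, hn⟩
    exact ⟨max m n, .imp_elim (hm.mono (hmono (le_max_left _ _)))
      (hn.mono (hmono (le_max_right _ _)))⟩
  · obtain ⟨n, hn | hn⟩ := hstep ψ
    exacts [.inl ⟨n, .hyp hn⟩, .inr ⟨n, .hyp hn.1⟩]
  · obtain ⟨n, hn | ⟨-, hn, -⟩⟩ := hstep (Fml.allN ψ)
    · exact ⟨n, .hyp hn⟩
    · obtain ⟨t, ht⟩ := hn ψ rfl
      exact (hcons _ (hψ t) ⟨n, .hyp ht⟩).elim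
  · obtain ⟨n, hn | ⟨-, -, hn⟩⟩ := hstep (Fml.allS ψ)
    · exact ⟨n, .hyp hn⟩
    · obtain ⟨t, ht⟩ := hn ψ rfl
      exact (hcons _ (hψ t) ⟨n, .hyp ht⟩).elim
  · exact hcons _ hφ ⟨0, .hyp List.mem_cons_self⟩

namespace Henkin

variable (H : Henkin T)

theorem th_imp {φ ψ : Fml} : H.Th (φ ➝ ψ) ↔ (H.Th φ → H.Th ψ) := by
  refine ⟨fun h => H.mp h, fun h => ?_⟩
  rcases H.complete φ with hφ | hφ
  · exact H.mp (H.of_prf (.imp_intro (.imp_intro (.hyp (by simp))))) (h hφ)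
  · exact H.mp (H.of_prf (.imp_intro (.imp_intro (.exfalso
      (.imp_elim (φ := φ) (.hyp (by simp [Fml.neg])) (.hyp (by simp))))))) hφ

theorem th_allN {φ : Fml} : H.Th (Fml.allN φ) ↔ ∀ t, H.Th (φ.instN t) :=
  ⟨fun h t => H.mp (H.of_prf (.imp_intro (.allN_elim t (.hyp (by simp))))) h, H.allN⟩

theorem th_allS {φ : Fml} : H.Th (Fml.allS φ) ↔ ∀ X, H.Th (φ.instS X) :=
  ⟨fun h X => H.mp (H.of_prf (.imp_intro (.allS_elim X (.hyp (by simp))))) h, H.allS⟩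

theorem th_subst {t u : Tm} (φ : Fml) (h : H.Th (t ≐ u)) (h' : H.Th (φ.instN t)) :
    H.Th (φ.instN u) :=
  H.mp (H.mp (H.of_prf (.imp_intro (.imp_intro
    (.eq_subst (t := t) φ (.hyp (by simp)) (.hyp (by simp)))))) h) h'

theorem th_eq_trans {t u v : Tm} (h : H.Th (t ≐ u)) (h' : H.Th (u ≐ v)) : H.Th (t ≐ v) := by
  have := H.th_subst (t.shift ≐ ♯0) h'
  simp only [Fml.instN_eq, Fml.subst, Tm.subst, Tm.shift_subst_scons, Tm.subst_var, scons] at this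
  exact this h

theorem th_eq_symm {t u : Tm} (h : H.Th (t ≐ u)) : H.Th (u ≐ t) := by
  have := H.th_subst (♯0 ≐ t.shift) h
  simp only [Fml.instN_eq, Fml.subst, Tm.subst, Tm.shift_subst_scons, Tm.subst_var, scons] at this
  exact this (H.of_prf (.eq_refl t))

/-- Provable equality of terms. -/
def setoid : Setoid Tm where
  r t u := H.Th (t ≐ u)
  iseqv := ⟨fun t => H.of_prf (.eq_refl t), H.th_eq_symm, H.th_eq_trans⟩

/-- If replacing one side at a time preserves theorems, an atomic predicate respects equality. -/
theorem th_congr₂ (P : Tm → Tm → Fml)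
    (hP : ∀ t u σ, (P t u).subst σ id = P (t.subst σ) (u.subst σ)) {t t' u u' : Tm}
    (ht : H.Th (t ≐ t')) (hu : H.Th (u ≐ u')) (h : H.Th (P t u)) : H.Th (P t' u') := by
  have h1 := H.th_subst (P ♯0 u.shift) ht
  have h2 := H.th_subst (P t'.shift ♯0) hu
  simp only [Fml.instN_eq, hP, Tm.subst, Tm.shift_subst_scons, Tm.subst_var, scons] at h1 h2
  exact h2 (h1 h)

theorem th_term_congr₂ (f : Tm → Tm → Tm)
    (hf : ∀ t u σ, (f t u).subst σ = f (t.subst σ) (u.subst σ)) {t t' u u' : Tm}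
    (ht : H.Th (t ≐ t')) (hu : H.Th (u ≐ u')) : H.Th (f t u ≐ f t' u') := by
  have h1 := H.th_subst (f t.shift u.shift ≐ f ♯0 u.shift) ht
  have h2 := H.th_subst (f t.shift u.shift ≐ f t'.shift ♯0) hu
  simp only [Fml.instN_eq, Fml.subst, hf, Tm.subst, Tm.shift_subst_scons, Tm.subst_var, scons] at h1 h2
  exact h2 (h1 (H.of_prf (.eq_refl _)))

/-- The term model. -/
def str : Str where
  N := Quotient H.setoid
  S := ℕ
  nonempty := ⟨0⟩
  zero := ⟦Tm.zero⟧
  one := ⟦Tm.one⟧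
  add := Quotient.map₂ Tm.add fun _ _ h _ _ h' => H.th_term_congr₂ Tm.add (fun _ _ _ => rfl) h h'
  mul := Quotient.map₂ Tm.mul fun _ _ h _ _ h' => H.th_term_congr₂ Tm.mul (fun _ _ _ => rfl) h h'
  lt := Quotient.lift₂ (fun t u => H.Th (t ⋖' u)) fun _ _ _ _ h h' => propext
    ⟨H.th_congr₂ Fml.lt (fun _ _ _ => rfl) h h',
      H.th_congr₂ Fml.lt (fun _ _ _ => rfl) (H.th_eq_symm h) (H.th_eq_symm h')⟩
  mem t X := Quotient.lift (fun t => H.Th (t ∈' X)) (fun _ _ h => propext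
    ⟨H.th_congr₂ (fun t _ => t ∈' X) (fun _ _ _ => rfl) (u := Tm.zero) h (H.of_prf (.eq_refl _)),
      H.th_congr₂ (fun t _ => t ∈' X) (fun _ _ _ => rfl) (u := Tm.zero) (H.th_eq_symm h)
        (H.of_prf (.eq_refl _))⟩) t

/-- The class of a term. -/
def cls (t : Tm) : H.str.N := (⟦t⟧ : Quotient H.setoid)

/-- An assignment of set variables, read in the term model. -/
def sets (ρ : ℕ → ℕ) : ℕ → H.str.S := ρ

theorem eval_str (σ : ℕ → Tm) (t : Tm) :
    t.eval (fun i => H.cls (σ i)) = H.cls (t.subst σ) := by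
  induction t with
  | var | zero | one => rfl
  | add t u iht ihu | mul t u iht ihu => rw [Tm.eval, iht, ihu]; rfl

/-- The truth lemma. -/
theorem sat_str (φ : Fml) : ∀ (σ : ℕ → Tm) (ρ : ℕ → ℕ),
    φ.sat (fun i => H.cls (σ i)) (H.sets ρ) ↔ H.Th (φ.subst σ ρ) := by
  induction φ with
  | eq t u =>
    intro σ ρ
    rw [Fml.sat, eval_str, eval_str]
    exact Quotient.eq (r := H.setoid)
  | lt t u => intro σ ρ; rw [Fml.sat, eval_str, eval_str]; rfl
  | mem t X => intro σ ρ; rw [Fml.sat, eval_str]; rfl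
  | bot => exact fun _ _ => ⟨False.elim, H.not_bot⟩
  | imp φ ψ ihφ ihψ => intro σ ρ; rw [Fml.sat, Fml.subst, th_imp, ihφ, ihψ]
  | allN φ ih =>
    intro σ ρ
    rw [Fml.sat, Fml.subst, th_allN]
    refine Quotient.forall.trans (forall_congr' fun t => ?_)
    rw [Fml.subst_upN_instN, ← ih]
    refine iff_of_eq ?_
    congr 1
    funext i
    cases i <;> rfl
  | allS φ ih =>
    intro σ ρ
    rw [Fml.sat, Fml.subst, th_allS]
    refine forall_congr' (α := ℕ) fun X => ?_
    rw [Fml.subst_upS_instS, ← ih]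
    refine iff_of_eq ?_
    congr 1

theorem exists_sat_str (e : ℕ → H.str.N) : ∃ σ : ℕ → Tm, e = fun i => H.cls (σ i) :=
  ⟨fun i => (e i).out, funext fun i => (Quotient.out_eq (e i)).symm⟩

end Henkin

/-- The completeness theorem. -/
theorem provable_of_valid {φ : Fml}
    (h : ∀ M : Str, (∀ ψ ∈ T, ∀ (e : ℕ → M.N) (s : ℕ → M.S), ψ.sat e s) →
      ∀ (e : ℕ → M.N) (s : ℕ → M.S), φ.sat e s) : Provable T φ := by
  by_contra hφ
  obtain ⟨H, hH⟩ := exists_henkin hφ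
  refine hH ?_
  rw [← φ.subst_var, ← H.sat_str]
  refine h H.str (fun ψ hψ e s => ?_) _ _
  obtain ⟨σ, rfl⟩ := H.exists_sat_str e
  exact (H.sat_str ψ σ s).2 (H.of_prf (Prf.subst (Γ := []) (.ax hψ) σ s))

end SOA

namespace SOA

/-! ### Definable predicates -/

section

variable {M : Str}

instance : Zero M.N := ⟨M.zero⟩
instance : One M.N := ⟨M.one⟩
instance : Add M.N := ⟨M.add⟩
instance : Mul M.N := ⟨M.mul⟩
instance : LT M.N := ⟨M.lt⟩
instance : LE M.N := ⟨fun a b => a < b ∨ a = b⟩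
instance : Membership M.N M.S := ⟨fun X a => M.mem a X⟩
instance : Nonempty M.S := M.nonempty

@[simp] theorem Tm.eval_var (e : ℕ → M.N) (i : ℕ) : (♯i).eval e = e i := rfl
@[simp] theorem Tm.eval_add (e : ℕ → M.N) (t u : Tm) : (t ∔ u).eval e = t.eval e + u.eval e := rfl
@[simp] theorem Tm.eval_mul (e : ℕ → M.N) (t u : Tm) : (t ⨰ u).eval e = t.eval e * u.eval e := rfl

namespace Fml

variable (e : ℕ → M.N) (s : ℕ → M.S) (t u : Tm) (φ ψ : Fml)

@[simp] theorem sat_eq : (t ≐ u).sat e s ↔ t.eval e = u.eval e := Iff.rfl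
@[simp] theorem sat_lt : (t ⋖' u).sat e s ↔ t.eval e < u.eval e := Iff.rfl
@[simp] theorem sat_mem (X : ℕ) : (t ∈' X).sat e s ↔ t.eval e ∈ s X := Iff.rfl
@[simp] theorem sat_bot : Fml.bot.sat e s ↔ False := Iff.rfl
@[simp] theorem sat_imp : (φ ➝ ψ).sat e s ↔ (φ.sat e s → ψ.sat e s) := Iff.rfl
@[simp] theorem sat_neg : (∼'φ).sat e s ↔ ¬φ.sat e s := Iff.rfl
@[simp] theorem sat_allN : φ.allN.sat e s ↔ ∀ a, φ.sat (scons a e) s := Iff.rfl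
@[simp] theorem sat_allS : φ.allS.sat e s ↔ ∀ X, φ.sat e (scons X s) := Iff.rfl
@[simp] theorem sat_and : (φ ⋏ ψ).sat e s ↔ φ.sat e s ∧ ψ.sat e s := by simp [Fml.and]
@[simp] theorem sat_or : (φ ⋎ ψ).sat e s ↔ φ.sat e s ∨ ψ.sat e s := by
  simp [Fml.or, or_iff_not_imp_left]
@[simp] theorem sat_iff : (φ ⟷ ψ).sat e s ↔ (φ.sat e s ↔ ψ.sat e s) := by
  simp [Fml.iff, iff_iff_implies_and_implies]
@[simp] theorem sat_exN : φ.exN.sat e s ↔ ∃ a, φ.sat (scons a e) s := by simp [exN]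
@[simp] theorem sat_exS : φ.exS.sat e s ↔ ∃ X, φ.sat e (scons X s) := by simp [exS]

end Fml

/-- The assignment without its value at `0`. -/
abbrev tail (e : ℕ → M.N) : ℕ → M.N := fun i => e (i + 1)

@[simp] theorem tail_scons (a : M.N) (e : ℕ → M.N) : tail (scons a e) = e := rfl

@[simp] theorem scons_zero {α : Type} (a : α) (f : ℕ → α) : scons a f 0 = a := rfl

@[simp] theorem scons_succ {α : Type} (a : α) (f : ℕ → α) (i : ℕ) : scons a f (i + 1) = f i := rfl

/-- Functions given by a term with parameters. -/
inductive TermFn : ((ℕ → M.N) → M.N) → Prop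
  | var (i : ℕ) : TermFn fun e => e i
  | const (c : M.N) : TermFn fun _ => c
  | add {t u : (ℕ → M.N) → M.N} : TermFn t → TermFn u → TermFn fun e => t e + u e
  | mul {t u : (ℕ → M.N) → M.N} : TermFn t → TermFn u → TermFn fun e => t e * u e

/-- Predicates given by a bounded-quantifier formula with parameters. -/
inductive D0 : ((ℕ → M.N) → Prop) → Prop
  | eq {t u : (ℕ → M.N) → M.N} : TermFn t → TermFn u → D0 fun e => t e = u e
  | lt {t u : (ℕ → M.N) → M.N} : TermFn t → TermFn u → D0 fun e => t e < u e
  | le {t u : (ℕ → M.N) → M.N} : TermFn t → TermFn u → D0 fun e => t e ≤ u e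
  | mem {t : (ℕ → M.N) → M.N} (X : M.S) : TermFn t → D0 fun e => t e ∈ X
  | not {P : (ℕ → M.N) → Prop} : D0 P → D0 fun e => ¬P e
  | and {P Q : (ℕ → M.N) → Prop} : D0 P → D0 Q → D0 fun e => P e ∧ Q e
  | or {P Q : (ℕ → M.N) → Prop} : D0 P → D0 Q → D0 fun e => P e ∨ Q e
  | imp {P Q : (ℕ → M.N) → Prop} : D0 P → D0 Q → D0 fun e => P e → Q e
  | iff {P Q : (ℕ → M.N) → Prop} : D0 P → D0 Q → D0 fun e => P e ↔ Q e
  | ball {t : (ℕ → M.N) → M.N} {P : (ℕ → M.N) → M.N → Prop} : TermFn t →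
      D0 (fun e => P (tail e) (e 0)) → D0 fun e => ∀ y < t e, P e y
  | bex {t : (ℕ → M.N) → M.N} {P : (ℕ → M.N) → M.N → Prop} : TermFn t →
      D0 (fun e => P (tail e) (e 0)) → D0 fun e => ∃ y < t e, P e y

/-- `Σ⁰₁` predicates, with parameters. -/
def S1 (P : (ℕ → M.N) → Prop) : Prop :=
  ∃ Q : (ℕ → M.N) → M.N → Prop, D0 (fun e => Q (tail e) (e 0)) ∧ ∀ e, P e ↔ ∃ y, Q e y

/-! #### Realization by formulas -/

/-- Interleave two sequences. -/
def join {α : Type} (f g : ℕ → α) (i : ℕ) : α := if i % 2 = 0 then f (i / 2) else g (i / 2)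

theorem join_even {α : Type} (f g : ℕ → α) (i : ℕ) : join f g (2 * i) = f i := by
  simp [join]

theorem join_odd {α : Type} (f g : ℕ → α) (i : ℕ) : join f g (2 * i + 1) = g i := by
  simp only [join]
  rw [if_neg (by omega), show (2 * i + 1) / 2 = i by omega]

theorem comp_join {α β : Type} (h : α → β) (f g : ℕ → α) (i : ℕ) :
    h (join f g i) = join (fun i => h (f i)) (fun i => h (g i)) i := by
  simp only [join]; split_ifs <;> rfl

theorem IsDelta00.subst {φ : Fml} (h : IsDelta00 φ) : ∀ (σ : ℕ → Tm) (ρ : ℕ → ℕ),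
    IsDelta00 (φ.subst σ ρ) := by
  induction h with
  | eq t u => exact fun _ _ => .eq _ _
  | lt t u => exact fun _ _ => .lt _ _
  | mem t X => exact fun _ _ => .mem _ _
  | bot => exact fun _ _ => .bot
  | imp _ _ ih ih' => exact fun _ _ => .imp (ih _ _) (ih' _ _)
  | ball t _ ih =>
    intro σ ρ
    have := IsDelta00.ball (t.subst σ) (ih (upN σ) ρ)
    rwa [← Tm.shift_subst_upN] at this
  | bex t _ ih =>
    intro σ ρ
    have := IsDelta00.bex (t.subst σ) (ih (upN σ) ρ)
    rwa [← Tm.shift_subst_upN] at this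

theorem IsDelta00.neg {φ : Fml} (h : IsDelta00 φ) : IsDelta00 (∼'φ) := .imp h .bot

theorem IsDelta00.and {φ ψ : Fml} (h : IsDelta00 φ) (h' : IsDelta00 ψ) : IsDelta00 (φ ⋏ ψ) :=
  .neg (.imp h (.neg h'))

theorem IsDelta00.or {φ ψ : Fml} (h : IsDelta00 φ) (h' : IsDelta00 ψ) : IsDelta00 (φ ⋎ ψ) :=
  .imp (.neg h) h'

theorem IsDelta00.iff {φ ψ : Fml} (h : IsDelta00 φ) (h' : IsDelta00 ψ) : IsDelta00 (φ ⟷ ψ) :=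
  .and (.imp h h') (.imp h' h)

/-- The renaming that makes room for more parameters on the right. -/
def renL (i : ℕ) : Tm := ♯(join (fun i => 2 * i) (fun i => 2 * (2 * i) + 1) i)

/-- The renaming that makes room for more parameters on the left. -/
def renR (i : ℕ) : Tm := ♯(join (fun i => 2 * i) (fun i => 2 * (2 * i + 1) + 1) i)

theorem eval_renL (e p q : ℕ → M.N) :
    (fun i => (renL i).eval (join e (join p q))) = join e p := by
  funext i
  rw [renL, Tm.eval_var, comp_join (join e (join p q))]
  simp only [join_even, join_odd]

theorem eval_renR (e p q : ℕ → M.N) :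
    (fun i => (renR i).eval (join e (join p q))) = join e q := by
  funext i
  rw [renR, Tm.eval_var, comp_join (join e (join p q))]
  simp only [join_even, join_odd]

/-- The renaming that brings a bound variable to the front. -/
def renB (i : ℕ) : Tm := ♯(join (fun i => Nat.casesOn i 0 fun j => 2 * j + 1) (fun i => 2 * i + 2) i)

theorem eval_renB (y : M.N) (e p : ℕ → M.N) :
    (fun i => (renB i).eval (scons y (join e p))) = join (scons y e) p := by
  funext i
  rw [renB, Tm.eval_var, comp_join (scons y (join e p))]
  congr 1
  · funext i
    cases i with
    | zero => rfl
    | succ i => exact join_even _ _ _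
  · funext i; exact join_odd _ _ _

theorem TermFn.realize {t : (ℕ → M.N) → M.N} (h : TermFn t) :
    ∃ (u : Tm) (p : ℕ → M.N), ∀ e, u.eval (join e p) = t e := by
  induction h with
  | var i => exact ⟨♯(2 * i), fun _ => 0, fun e => join_even _ _ _⟩
  | const c => exact ⟨♯(2 * 0 + 1), fun _ => c, fun e => join_odd _ _ _⟩
  | add _ _ ih ih' =>
    obtain ⟨u, p, hp⟩ := ih
    obtain ⟨v, q, hq⟩ := ih'
    exact ⟨u.subst renL ∔ v.subst renR, join p q, fun e => by
      rw [Tm.eval_add, Tm.eval_subst, Tm.eval_subst, eval_renL, eval_renR, hp, hq]⟩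
  | mul _ _ ih ih' =>
    obtain ⟨u, p, hp⟩ := ih
    obtain ⟨v, q, hq⟩ := ih'
    exact ⟨u.subst renL ⨰ v.subst renR, join p q, fun e => by
      rw [Tm.eval_mul, Tm.eval_subst, Tm.eval_subst, eval_renL, eval_renR, hp, hq]⟩

theorem TermFn.realize₂ {t t' : (ℕ → M.N) → M.N} (h : TermFn t) (h' : TermFn t') :
    ∃ (u u' : Tm) (p : ℕ → M.N), ∀ e, u.eval (join e p) = t e ∧ u'.eval (join e p) = t' e := by
  obtain ⟨u, p, hp⟩ := h.realize
  obtain ⟨v, q, hq⟩ := h'.realize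
  exact ⟨u.subst renL, v.subst renR, join p q, fun e => by
    rw [Tm.eval_subst, Tm.eval_subst, eval_renL, eval_renR, hp, hq]; exact ⟨rfl, rfl⟩⟩

/-- `φ` defines `P` with parameters `p`, `s`. -/
def Realizes (φ : Fml) (p : ℕ → M.N) (s : ℕ → M.S) (P : (ℕ → M.N) → Prop) : Prop :=
  ∀ e, φ.sat (join e p) s ↔ P e

theorem Realizes.left {φ : Fml} {p : ℕ → M.N} {s : ℕ → M.S} {P : (ℕ → M.N) → Prop}
    (h : Realizes φ p s P) (q : ℕ → M.N) (s' : ℕ → M.S) :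
    Realizes (φ.subst renL fun i => 2 * i) (join p q) (join s s') P := by
  intro e
  simp only [Fml.sat_subst, eval_renL, join_even]
  exact h e

theorem Realizes.right {φ : Fml} {p : ℕ → M.N} {s : ℕ → M.S} {P : (ℕ → M.N) → Prop}
    (h : Realizes φ p s P) (q : ℕ → M.N) (s' : ℕ → M.S) :
    Realizes (φ.subst renR fun i => 2 * i + 1) (join q p) (join s' s) P := by
  intro e
  simp only [Fml.sat_subst, eval_renR, join_odd]
  exact h e

/-- Two definitions can share their parameters. -/
theorem Realizes.merge {P Q : (ℕ → M.N) → Prop}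
    (h : ∃ φ, IsDelta00 φ ∧ ∃ p s, Realizes φ p s P)
    (h' : ∃ φ, IsDelta00 φ ∧ ∃ p s, Realizes φ p s Q) :
    ∃ φ ψ, IsDelta00 φ ∧ IsDelta00 ψ ∧ ∃ p s, Realizes φ p s P ∧ Realizes ψ p s Q := by
  obtain ⟨φ, hφ, p, s, h⟩ := h
  obtain ⟨ψ, hψ, q, s', h'⟩ := h'
  exact ⟨_, _, hφ.subst _ _, hψ.subst _ _, _, _, h.left q s', h'.right p s⟩

theorem Realizes.quantifier {t : (ℕ → M.N) → M.N} {P : (ℕ → M.N) → Prop} (ht : TermFn t)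
    (h : ∃ φ, IsDelta00 φ ∧ ∃ p s, Realizes φ p s P) :
    ∃ (φ : Fml) (u : Tm), IsDelta00 φ ∧ ∃ p s, (∀ e y, φ.sat (scons y (join e p)) s ↔ P (scons y e)) ∧
      ∀ e y, u.shift.eval (scons y (join e p)) = t e := by
  obtain ⟨φ, hφ, p, s, h⟩ := h
  obtain ⟨u, q, hu⟩ := ht.realize
  refine ⟨(φ.subst renL id).subst renB id, u.subst renR, (hφ.subst _ _).subst _ _, join p q, s,
    fun e y => ?_, fun e y => ?_⟩
  · rw [Fml.sat_subst, eval_renB, Fml.sat_subst, eval_renL]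
    exact h _
  · rw [Tm.eval_shift, Tm.eval_subst, eval_renR, hu]

theorem D0.realize {P : (ℕ → M.N) → Prop} (h : D0 P) :
    ∃ φ, IsDelta00 φ ∧ ∃ p s, Realizes φ p s P := by
  have s₀ : ℕ → M.S := fun _ => Classical.arbitrary _
  induction h with
  | eq ht hu =>
    obtain ⟨u, v, p, h⟩ := ht.realize₂ hu
    exact ⟨u ≐ v, .eq _ _, p, s₀, fun e => by simp [h]⟩
  | lt ht hu =>
    obtain ⟨u, v, p, h⟩ := ht.realize₂ hu
    exact ⟨u ⋖' v, .lt _ _, p, s₀, fun e => by simp [h]⟩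
  | le ht hu =>
    obtain ⟨u, v, p, h⟩ := ht.realize₂ hu
    exact ⟨u ⋖' v ⋎ u ≐ v, .or (.lt _ _) (.eq _ _), p, s₀, fun e => by simp [h]; rfl⟩
  | mem X ht =>
    obtain ⟨u, p, h⟩ := ht.realize
    exact ⟨u ∈' 0, .mem _ _, p, fun _ => X, fun e => by simp [h]⟩
  | not _ ih =>
    obtain ⟨φ, hφ, p, s, h⟩ := ih
    exact ⟨∼'φ, hφ.neg, p, s, fun e => by simp [h e]⟩
  | and _ _ ih ih' =>
    obtain ⟨φ, ψ, hφ, hψ, p, s, h, h'⟩ := Realizes.merge ih ih'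
    exact ⟨φ ⋏ ψ, hφ.and hψ, p, s, fun e => by simp [h e, h' e]⟩
  | or _ _ ih ih' =>
    obtain ⟨φ, ψ, hφ, hψ, p, s, h, h'⟩ := Realizes.merge ih ih'
    exact ⟨φ ⋎ ψ, hφ.or hψ, p, s, fun e => by simp [h e, h' e]⟩
  | imp _ _ ih ih' =>
    obtain ⟨φ, ψ, hφ, hψ, p, s, h, h'⟩ := Realizes.merge ih ih'
    exact ⟨φ ➝ ψ, hφ.imp hψ, p, s, fun e => by simp [h e, h' e]⟩
  | iff _ _ ih ih' =>
    obtain ⟨φ, ψ, hφ, hψ, p, s, h, h'⟩ := Realizes.merge ih ih'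
    exact ⟨φ ⟷ ψ, hφ.iff hψ, p, s, fun e => by simp [h e, h' e]⟩
  | ball ht _ ih =>
    obtain ⟨φ, u, hφ, p, s, h, hu⟩ := Realizes.quantifier ht ih
    exact ⟨_, .ball u hφ, p, s, fun e => by simp [h, hu]⟩
  | bex ht _ ih =>
    obtain ⟨φ, u, hφ, p, s, h, hu⟩ := Realizes.quantifier ht ih
    exact ⟨_, .bex u hφ, p, s, fun e => by simp [h, hu]⟩

theorem S1.realize {P : (ℕ → M.N) → Prop} (h : S1 P) :
    ∃ φ, IsDelta00 φ ∧ ∃ p s, ∀ e, φ.exN.sat (join e p) s ↔ P e := by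
  obtain ⟨Q, hQ, h⟩ := h
  obtain ⟨φ, _, hφ, p, s, h', -⟩ := Realizes.quantifier (.const 0) hQ.realize
  exact ⟨φ, hφ, p, s, fun e => by simp [h, h']⟩

/-- A `D0` predicate of the variables after the first one is `S1`. -/
theorem D0.toS1 {P : (ℕ → M.N) → Prop} (h : D0 fun e => P (tail e)) : S1 P :=
  ⟨fun e _ => P e, h, fun _ => ⟨fun h => ⟨0, h⟩, fun ⟨_, h⟩ => h⟩⟩

end

/-- Models of `RCA₀`. -/
class RCA (M : Str) : Prop where
  sat : ∀ φ ∈ RCA0, ∀ (e : ℕ → M.N) (s : ℕ → M.S), φ.sat e s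

variable {M : Str} [RCA M]

theorem induction_S1 {P : M.N → Prop} (hP : S1 fun e : ℕ → M.N => P (e 0)) (h0 : P 0)
    (hs : ∀ n, P n → P (n + 1)) (n : M.N) : P n := by
  obtain ⟨φ, hφ, p, s, h⟩ := hP.realize
  have key := RCA.sat _ (RCA0.induction (.ex (hφ.subst (upN renB) id))) (join (fun _ => 0) p) s
  have hsat : ∀ y, ((φ.subst (upN renB) id).exN).sat (scons y (join (fun _ => 0) p)) s ↔ P y := by
    intro y
    have : (φ.subst (upN renB) id).exN = φ.exN.subst renB id := rfl
    rw [this, Fml.sat_subst, eval_renB]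
    exact h _
  rw [Fml.sat_imp, Fml.sat_and, Fml.sat_allN, Fml.sat_allN] at key
  refine (hsat n).1 (key ⟨?_, fun a => ?_⟩ n)
  · rw [Fml.instN_eq, Fml.sat_subst]
    convert (hsat 0).2 h0 using 1
    all_goals (funext i; cases i <;> rfl)
  · rw [Fml.sat_imp, hsat, Fml.succN, Fml.sat_subst]
    intro h
    convert (hsat _).2 (hs a h) using 1
    all_goals (funext i; cases i <;> rfl)

theorem induction_D0 {P : M.N → Prop} (hP : D0 fun e : ℕ → M.N => P (e 1)) (h0 : P 0)
    (hs : ∀ n, P n → P (n + 1)) (n : M.N) : P n :=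
  induction_S1 (D0.toS1 hP) h0 hs n

theorem comprehension_delta {P : M.N → Prop} (hP : S1 fun e : ℕ → M.N => P (e 0))
    (hP' : S1 fun e : ℕ → M.N => ¬P (e 0)) : ∃ X : M.S, ∀ n, n ∈ X ↔ P n := by
  obtain ⟨φ, hφ, p, s, h⟩ := hP.realize
  obtain ⟨ψ, hψ, p', s', h'⟩ := hP'.realize
  let r : ℕ → Tm := fun i => (renL i).subst renB
  let r' : ℕ → Tm := fun i => (renR i).subst renB
  let φ' := φ.subst (upN r) fun i => 2 * i
  let ψ' := ψ.neg.subst (upN r') fun i => 2 * i + 1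
  have h1 : ∀ y, φ'.exN.sat (scons y (join (fun _ => 0) (join p p'))) (join s s') ↔ P y := by
    intro y
    have : φ'.exN = φ.exN.subst r fun i => 2 * i := rfl
    simp only [this, Fml.sat_subst, join_even, r, Tm.eval_subst, eval_renB, eval_renL]
    exact h _
  have h2 : ∀ y, ψ'.allN.sat (scons y (join (fun _ => 0) (join p p'))) (join s s') ↔ P y := by
    intro y
    have : ψ'.allN = ψ.neg.allN.subst r' fun i => 2 * i + 1 := rfl
    simp only [this, Fml.sat_subst, join_odd, r', Tm.eval_subst, eval_renB, eval_renR]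
    exact not_iff_not.1 (h' (scons y fun _ => 0))
  have key := RCA.sat _ (RCA0.comprehension (φ := φ'.exN) (ψ := ψ'.allN) (.ex (hφ.subst _ _))
    (.all (hψ.neg.subst _ _)))
    (join (fun _ => 0) (join p p')) (join s s')
  simp only [Fml.sat_imp, Fml.sat_exS, Fml.sat_allN, Fml.sat_iff, Fml.shiftS, Fml.sat_subst,
    Fml.sat_mem, Tm.eval_var] at key
  obtain ⟨X, hX⟩ := key fun a => (h1 a).trans (h2 a).symm
  exact ⟨X, fun n => (hX n).trans (h1 n)⟩

theorem comprehension_D0 {P : M.N → Prop} (hP : D0 fun e : ℕ → M.N => P (e 1)) :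
    ∃ X : M.S, ∀ n, n ∈ X ↔ P n :=
  comprehension_delta (D0.toS1 hP) (D0.toS1 hP.not)

end SOA

namespace SOA

/-! ### Arithmetic in models of `RCA₀` -/

variable {M : Str} [RCA M]

namespace RCA

theorem holds {φ : Fml} (h : φ ∈ RCA0) (e : ℕ → M.N) : φ.sat e fun _ => Classical.arbitrary _ :=
  RCA.sat φ h e _

theorem succ_ne_zero (x : M.N) : x + 1 ≠ 0 := holds .succ_ne_zero fun _ => x

theorem succ_inj {x y : M.N} : x + 1 = y + 1 → x = y := holds .succ_inj (scons x fun _ => y)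

theorem add_zero (x : M.N) : x + 0 = x := holds .add_zero fun _ => x

theorem add_succ (x y : M.N) : x + (y + 1) = x + y + 1 := holds .add_succ (scons x fun _ => y)

theorem mul_zero (x : M.N) : x * 0 = 0 := holds .mul_zero fun _ => x

theorem mul_succ (x y : M.N) : x * (y + 1) = x * y + x := holds .mul_succ (scons x fun _ => y)

theorem not_lt_zero (x : M.N) : ¬x < 0 := holds .not_lt_zero fun _ => x

theorem lt_succ (x y : M.N) : x < y + 1 ↔ x < y ∨ x = y := by
  have := holds .lt_succ (scons x fun _ => y)
  rwa [Fml.sat_iff, Fml.sat_or] at this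

theorem add_assoc (x y z : M.N) : x + y + z = x + (y + z) := by
  refine induction_D0 (P := fun z => x + y + z = x + (y + z)) (by repeat' constructor) ?_ ?_ z
  · simp only [add_zero]
  · intro n ih; simp only [add_succ, ih]

theorem zero_add (x : M.N) : 0 + x = x := by
  refine induction_D0 (P := fun x => 0 + x = x) (by repeat' constructor) (add_zero _) ?_ x
  intro n ih; rw [add_succ, ih]

theorem succ_add (x y : M.N) : x + 1 + y = x + y + 1 := by
  refine induction_D0 (P := fun y => x + 1 + y = x + y + 1) (by repeat' constructor) ?_ ?_ y
  · simp only [add_zero]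
  · intro n ih; simp only [add_succ, ih]

theorem add_comm (x y : M.N) : x + y = y + x := by
  refine induction_D0 (P := fun y => x + y = y + x) (by repeat' constructor) ?_ ?_ y
  · rw [add_zero, zero_add]
  · intro n ih; rw [add_succ, succ_add, ih]

theorem mul_add (x y z : M.N) : x * (y + z) = x * y + x * z := by
  refine induction_D0 (P := fun z => x * (y + z) = x * y + x * z) (by repeat' constructor) ?_ ?_ z
  · simp only [add_zero, mul_zero]
  · intro n ih; rw [add_succ, mul_succ, ih, mul_succ, add_assoc]

theorem zero_mul (x : M.N) : 0 * x = 0 := by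
  refine induction_D0 (P := fun x => 0 * x = 0) (by repeat' constructor) (mul_zero _) ?_ x
  intro n ih; rw [mul_succ, ih, add_zero]

theorem succ_mul (x y : M.N) : (x + 1) * y = x * y + y := by
  refine induction_D0 (P := fun y => (x + 1) * y = x * y + y) (by repeat' constructor) ?_ ?_ y
  · simp only [add_zero, mul_zero]
  · intro n ih
    rw [mul_succ, ih, mul_succ, add_assoc, add_assoc, add_comm n, succ_add, add_assoc]

theorem mul_comm (x y : M.N) : x * y = y * x := by
  refine induction_D0 (P := fun y => x * y = y * x) (by repeat' constructor) ?_ ?_ y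
  · rw [mul_zero, zero_mul]
  · intro n ih; rw [mul_succ, succ_mul, ih]

theorem mul_assoc (x y z : M.N) : x * y * z = x * (y * z) := by
  refine induction_D0 (P := fun z => x * y * z = x * (y * z)) (by repeat' constructor) ?_ ?_ z
  · simp only [mul_zero]
  · intro n ih; rw [mul_succ, mul_succ, mul_add, ih]

theorem mul_one (x : M.N) : x * 1 = x := by
  rw [← zero_add 1, mul_succ, mul_zero, zero_add]

end RCA

open RCA in
instance : CommSemiring M.N where
  add_assoc := add_assoc
  zero_add := zero_add
  add_zero := add_zero
  add_comm := add_comm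
  nsmul := nsmulRec
  left_distrib := mul_add
  right_distrib x y z := by rw [RCA.mul_comm, RCA.mul_add, RCA.mul_comm z, RCA.mul_comm z]
  zero_mul := zero_mul
  mul_zero := mul_zero
  mul_assoc := mul_assoc
  one_mul x := by rw [RCA.mul_comm, RCA.mul_one]
  mul_one := mul_one
  mul_comm := mul_comm

namespace RCA

theorem lt_add_one (x : M.N) : x < x + 1 := (lt_succ _ _).2 (.inr rfl)

theorem lt_trans {x y z : M.N} (h : x < y) (h' : y < z) : x < z := by
  refine induction_D0 (P := fun z => y < z → x < z) (by repeat' constructor)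
    (fun h => (not_lt_zero _ h).elim) (fun n ih h => ?_) z h'
  rcases (lt_succ _ _).1 h with h | rfl
  exacts [(lt_succ _ _).2 (.inl (ih h)), (lt_succ _ _).2 (.inl ‹_›)]

theorem succ_lt_succ {x y : M.N} (h : x < y) : x + 1 < y + 1 := by
  refine induction_D0 (P := fun y => x < y → x + 1 < y + 1) (by repeat' constructor)
    (fun h => (not_lt_zero _ h).elim) (fun n ih h => ?_) y h
  rcases (lt_succ _ _).1 h with h | rfl
  exacts [(lt_succ _ _).2 (.inl (ih h)), lt_add_one _]

theorem lt_irrefl (x : M.N) : ¬x < x := by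
  refine induction_D0 (P := fun x => ¬x < x) (by repeat' constructor) (not_lt_zero _)
    (fun n ih h => ?_) x
  rcases (lt_succ _ _).1 h with h | h
  · exact ih (lt_trans (lt_add_one n) h)
  · exact ih (by have := lt_add_one n; rwa [h] at this)

theorem lt_trichotomy (x y : M.N) : x < y ∨ x = y ∨ y < x := by
  refine induction_D0 (P := fun y => x < y ∨ x = y ∨ y < x) (by repeat' constructor)
    ?_ (fun n ih => ?_) y
  · refine .inr (induction_D0 (P := fun x => x = 0 ∨ 0 < x) (by repeat' constructor)
      (.inl rfl) (fun n ih => .inr ?_) x)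
    rcases ih with rfl | h
    exacts [lt_add_one _, lt_trans h (lt_add_one _)]
  · rcases ih with h | rfl | h
    · exact .inl (lt_trans h (lt_add_one _))
    · exact .inl (lt_add_one _)
    · rcases (lt_succ _ _).1 (succ_lt_succ h) with h | h
      exacts [.inr (.inr h), .inr (.inl h.symm)]

end RCA

open RCA in
noncomputable instance : LinearOrder M.N where
  le_refl x := .inr rfl
  le_trans x y z h h' := by
    rcases h with h | rfl
    · rcases h' with h' | rfl
      exacts [.inl (lt_trans h h'), .inl h]
    · exact h'
  lt_iff_le_not_ge x y := by
    refine ⟨fun h => ⟨.inl h, ?_⟩, ?_⟩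
    · rintro (h' | rfl)
      exacts [lt_irrefl _ (lt_trans h h'), lt_irrefl _ h]
    · rintro ⟨h | rfl, h'⟩
      exacts [h, (h' (.inr rfl)).elim]
  le_antisymm x y h h' := by
    rcases h with h | rfl
    · rcases h' with h' | rfl
      exacts [(lt_irrefl _ (lt_trans h h')).elim, rfl]
    · rfl
  le_total x y := by
    rcases lt_trichotomy x y with h | h | h
    exacts [.inl (.inl h), .inl (.inr h), .inr (.inl h)]
  toDecidableLE := Classical.decRel _

namespace RCA

theorem lt_add_one_iff {x y : M.N} : x < y + 1 ↔ x ≤ y := lt_succ x y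

theorem exists_add_of_le {x y : M.N} (h : x ≤ y) : ∃ c, y = x + c := by
  have := induction_D0 (P := fun y => x ≤ y → ∃ c < y + 1, y = x + c) (by repeat' constructor)
    (fun h => ?_) (fun n ih h => ?_) y h
  · obtain ⟨c, -, hc⟩ := this
    exact ⟨c, hc⟩
  · rcases h with h | rfl
    exacts [(not_lt_zero _ h).elim, ⟨0, lt_add_one _, (add_zero _).symm⟩]
  · rcases h with h | rfl
    · obtain ⟨c, hc, rfl⟩ := ih (lt_add_one_iff.1 h)
      exact ⟨c + 1, succ_lt_succ hc, add_assoc _ _ _⟩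
    · exact ⟨0, lt_add_one_iff.2 (not_lt.1 (not_lt_zero _)), (add_zero _).symm⟩

theorem zero_le (x : M.N) : 0 ≤ x := not_lt.1 (not_lt_zero x)

theorem add_lt_add_right {x y : M.N} (h : x < y) (z : M.N) : x + z < y + z := by
  refine induction_D0 (P := fun z => x + z < y + z) (by repeat' constructor) ?_ (fun n ih => ?_) z
  · rwa [add_zero, add_zero]
  · rw [add_succ, add_succ]; exact succ_lt_succ ih

theorem add_left_lt {x y : M.N} (h : x < y) (z : M.N) : z + x < z + y := by
  rw [add_comm z, add_comm z]; exact add_lt_add_right h z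

theorem mul_lt_mul_succ {x y : M.N} (h : x < y) (z : M.N) : (z + 1) * x < (z + 1) * y := by
  refine induction_D0 (P := fun z => (z + 1) * x < (z + 1) * y) (by repeat' constructor)
    ?_ (fun n ih => ?_) z
  · rwa [zero_add, one_mul, one_mul]
  · rw [succ_mul, succ_mul (n + 1)]
    exact lt_trans (add_lt_add_right ih _) (add_left_lt h _)

theorem exists_eq_succ {x : M.N} (h : 0 < x) : ∃ y, x = y + 1 := by
  have := induction_D0 (P := fun x => 0 < x → ∃ y < x, x = y + 1) (by repeat' constructor)
    (fun h => (lt_irrefl _ h).elim) (fun n _ _ => ⟨n, lt_add_one _, rfl⟩) x h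
  obtain ⟨y, -, hy⟩ := this
  exact ⟨y, hy⟩

end RCA

open RCA

instance : IsStrictOrderedRing M.N where
  add_le_add_left x y h z := by
    rcases h with h | rfl
    exacts [.inl (RCA.add_lt_add_right h z), le_rfl]
  le_of_add_le_add_left x y z h := not_lt.1 fun h' => not_lt.2 h (add_left_lt h' x)
  zero_le_one := RCA.zero_le 1
  exists_pair_ne := ⟨1, 0, by rw [← _root_.zero_add (1 : M.N)]; exact succ_ne_zero 0⟩
  mul_lt_mul_of_pos_left x hx y z h := by
    obtain ⟨w, rfl⟩ := exists_eq_succ hx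
    exact mul_lt_mul_succ h w
  mul_lt_mul_of_pos_right x hx y z h := by
    obtain ⟨w, rfl⟩ := exists_eq_succ hx
    rw [RCA.mul_comm, RCA.mul_comm z]
    exact mul_lt_mul_succ h w

instance : CanonicallyOrderedAdd M.N where
  exists_add_of_le := RCA.exists_add_of_le
  le_self_add x y := by
    conv_lhs => rw [← RCA.add_zero x]
    exact add_le_add_right (RCA.zero_le y) x
  le_add_self x y := by
    conv_lhs => rw [← RCA.zero_add x]
    exact add_le_add_left (RCA.zero_le y) x

end SOA

namespace SOA

/-! ### Closure properties of the definability classes -/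

section

variable {M : Str}

theorem TermFn.subst {t : (ℕ → M.N) → M.N} (ht : TermFn t) {σ : ℕ → (ℕ → M.N) → M.N}
    (hσ : ∀ i, TermFn (σ i)) : TermFn fun e => t fun i => σ i e := by
  induction ht with
  | var i => exact hσ i
  | const c => exact .const c
  | add _ _ ih ih' => exact .add ih ih'
  | mul _ _ ih ih' => exact .mul ih ih'

theorem TermFn.lift {σ : ℕ → (ℕ → M.N) → M.N} (hσ : ∀ i, TermFn (σ i)) (i : ℕ) :
    TermFn (scons (fun e => e 0) (fun i e => σ i (tail e)) i : (ℕ → M.N) → M.N) := by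
  cases i with
  | zero => exact .var 0
  | succ i => exact (hσ i).subst (σ := fun i e => e (i + 1)) fun i => .var (i + 1)

theorem D0.subst {P : (ℕ → M.N) → Prop} (hP : D0 P) : ∀ {σ : ℕ → (ℕ → M.N) → M.N},
    (∀ i, TermFn (σ i)) → D0 fun e => P fun i => σ i e := by
  induction hP with
  | eq h h' => exact fun hσ => .eq (h.subst hσ) (h'.subst hσ)
  | lt h h' => exact fun hσ => .lt (h.subst hσ) (h'.subst hσ)
  | le h h' => exact fun hσ => .le (h.subst hσ) (h'.subst hσ)
  | mem X h => exact fun hσ => .mem X (h.subst hσ)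
  | not _ ih => exact fun hσ => .not (ih hσ)
  | and _ _ ih ih' => exact fun hσ => .and (ih hσ) (ih' hσ)
  | or _ _ ih ih' => exact fun hσ => .or (ih hσ) (ih' hσ)
  | imp _ _ ih ih' => exact fun hσ => .imp (ih hσ) (ih' hσ)
  | iff _ _ ih ih' => exact fun hσ => .iff (ih hσ) (ih' hσ)
  | ball h _ ih => exact fun hσ => .ball (h.subst hσ) (ih (TermFn.lift hσ))
  | bex h _ ih => exact fun hσ => .bex (h.subst hσ) (ih (TermFn.lift hσ))

theorem D0.app₂ {R : M.N → M.N → Prop} (h : D0 fun e : ℕ → M.N => R (e 0) (e 1))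
    {t u : (ℕ → M.N) → M.N} (ht : TermFn t) (hu : TermFn u) : D0 fun e => R (t e) (u e) :=
  h.subst (σ := scons t fun _ => u) fun i => by cases i <;> assumption

theorem S1.of_D0 {P : (ℕ → M.N) → Prop} (h : D0 P) : S1 P :=
  D0.toS1 (h.subst (σ := fun i e => e (i + 1)) fun i => .var (i + 1))

end

variable {M : Str} [RCA M]

open RCA (exists_eq_succ)

theorem S1.ex {P : (ℕ → M.N) → M.N → Prop} (h : S1 fun e => P (tail e) (e 0)) :
    S1 fun e => ∃ y, P e y := by
  obtain ⟨Q, hQ, h⟩ := h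
  refine ⟨fun e w => ∃ y < w + 1, ∃ z < w + 1, Q (scons y e) z,
    .bex (.add (.var 0) (.const 1)) (.bex (.add (.var 1) (.const 1)) ?_), fun e => ?_⟩
  · have := hQ.subst (σ := scons (fun e => e 0) (scons (fun e => e 1) fun i e => e (i + 3)))
      fun i => by
        rcases i with _ | _ | i
        exacts [.var 0, .var 1, .var (i + 3)]
    convert this using 2
    refine iff_of_eq (congrArg₂ Q ?_ rfl)
    funext i
    cases i <;> rfl
  · constructor
    · rintro ⟨y, hy⟩
      obtain ⟨z, hz⟩ := (h (scons y e)).1 hy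
      exact ⟨max y z, y, RCA.lt_add_one_iff.2 (le_max_left _ _), z, RCA.lt_add_one_iff.2 (le_max_right _ _),
        hz⟩
    · rintro ⟨w, y, -, z, -, hz⟩
      exact ⟨y, (h (scons y e)).2 ⟨z, hz⟩⟩

/-! ### Minimization and collection -/

/-- The least number principle for `Π⁰₁` predicates. -/
theorem exists_least {R : M.N → Prop} (hR : S1 fun e : ℕ → M.N => ¬R (e 0)) (h : ∃ x, R x) :
    ∃ x, R x ∧ ∀ y < x, ¬R y := by
  by_contra! hc
  obtain ⟨Q, hQ, hQR⟩ := hR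
  have hsat : ∀ y, ¬R y ↔ ∃ z, Q (fun _ => y) z := fun y => hQR fun _ => y
  have key := induction_S1 (P := fun n => ∃ w, ∀ y < n, ∃ z < w, Q (fun _ => y) z)
    (.ex (.of_D0 (.ball (.var 1) (.bex (.var 1) (hQ.subst (σ := scons (fun e => e 0) fun _ e => e 1)
      fun i => ?_))))) ⟨0, fun y hy => (RCA.not_lt_zero y hy).elim⟩ fun n ⟨w, hw⟩ => ?_
  · obtain ⟨x, hx⟩ := h
    obtain ⟨w, hw⟩ := key (x + 1)
    obtain ⟨z, -, hz⟩ := hw x (lt_add_one x)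
    exact (hsat x).2 ⟨z, hz⟩ hx
  · cases i
    exacts [.var 0, .var 1]
  · have hn : ¬R n := fun hn => by
      obtain ⟨y, hy, hy'⟩ := hc n hn
      obtain ⟨z, -, hz⟩ := hw y hy
      exact (hsat y).2 ⟨z, hz⟩ hy'
    obtain ⟨z, hz⟩ := (hsat n).1 hn
    refine ⟨max w (z + 1), fun y hy => ?_⟩
    rcases (RCA.lt_add_one_iff.1 hy).lt_or_eq with hy | rfl
    · obtain ⟨z', hz', h'⟩ := hw y hy
      exact ⟨z', lt_max_of_lt_left hz', h'⟩
    · exact ⟨z, lt_max_of_lt_right (lt_add_one z), hz⟩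

theorem exists_least_D0 {R : M.N → Prop} (hR : D0 fun e : ℕ → M.N => R (e 0)) (h : ∃ x, R x) :
    ∃ x, R x ∧ ∀ y < x, ¬R y :=
  exists_least (.of_D0 hR.not) h

/-- Collection for bounded-quantifier formulas. -/
theorem collection {R : M.N → M.N → Prop} (hR : D0 fun e : ℕ → M.N => R (e 0) (e 1)) (a : M.N)
    (h : ∀ x < a, ∃ y, R x y) : ∃ b, ∀ x < a, ∃ y < b, R x y := by
  have key := induction_S1 (P := fun n => ∃ w, ∀ x < n, ∃ y < w, x < a → R x y)
    (.ex (.of_D0 (.ball (.var 1) (.bex (.var 1) (.imp (.lt (.var 1) (.const a))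
      (hR.app₂ (.var 1) (.var 0))))))) ⟨0, fun y hy => (RCA.not_lt_zero y hy).elim⟩
    fun n ⟨w, hw⟩ => ?_
  · obtain ⟨w, hw⟩ := key a
    refine ⟨w, fun x hx => ?_⟩
    obtain ⟨y, hy, h'⟩ := hw x hx
    exact ⟨y, hy, h' hx⟩
  · obtain ⟨z, hz⟩ : ∃ y, n < a → R n y := by
      by_cases hn : n < a
      · exact (h n hn).imp fun _ h _ => h
      · exact ⟨0, fun h => (hn h).elim⟩
    refine ⟨max w (z + 1), fun y hy => ?_⟩
    rcases (RCA.lt_add_one_iff.1 hy).lt_or_eq with hy | rfl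
    · obtain ⟨z', hz', h'⟩ := hw y hy
      exact ⟨z', lt_max_of_lt_left hz', h'⟩
    · exact ⟨z, lt_max_of_lt_right (lt_add_one z), hz⟩

/-! ### Codes of finite sets -/

theorem dvd_of_dvd_add {x y z : M.N} (hx : 0 < x) (h : x ∣ y + z) (h' : x ∣ y) : x ∣ z := by
  obtain ⟨p, rfl⟩ := h'
  obtain ⟨q, hq⟩ := h
  have hpq : p ≤ q := by
    refine le_of_mul_le_mul_left ?_ hx
    rw [← hq]
    exact le_self_add
  obtain ⟨r, rfl⟩ := RCA.exists_add_of_le hpq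
  refine ⟨r, ?_⟩
  rw [_root_.mul_add] at hq
  exact add_left_cancel hq

/-- The `i`-th modulus for the base `b`. -/
abbrev modulus (b i : M.N) : M.N := 1 + (i + 1) * b

/-- `i` belongs to the finite set with code `a` for the base `b`. -/
def InCode (b a i : M.N) : Prop := ∃ q < a + 1, a = modulus b i * q

theorem modulus_pos (b i : M.N) : 0 < modulus b i :=
  lt_of_lt_of_le one_pos le_self_add

theorem inCode_iff {b a i : M.N} : InCode b a i ↔ modulus b i ∣ a := by
  refine ⟨fun ⟨q, _, h⟩ => ⟨q, h⟩, fun ⟨q, h⟩ => ⟨q, RCA.lt_add_one_iff.2 ?_, h⟩⟩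
  rw [h, modulus, _root_.add_mul, _root_.one_mul]
  exact le_self_add

omit [RCA M] in
theorem InCode.D0 {t u v : (ℕ → M.N) → M.N} (ht : TermFn t) (hu : TermFn u) (hv : TermFn v) :
    D0 fun e => InCode (t e) (u e) (v e) := by
  have h : ∀ {t : (ℕ → M.N) → M.N}, TermFn t → TermFn fun e => t (tail e) :=
    fun ht => ht.subst fun i => .var (i + 1)
  exact .bex (.add hu (.const 1)) (.eq (h hu) (.mul (.add (.const 1) (.mul (.add (h hv) (.const 1))
    (h ht))) (.var 0)))

/-- `b` is a base for coding subsets of `{i | i < n}`, all of them with codes at most `a`. -/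
def Base (n b a : M.N) : Prop :=
  0 < a ∧ 0 < b ∧ (∀ i < n, ∃ q < b + 1, b = (i + 1) * q) ∧ ∀ i < n, InCode b a i

theorem exists_base (n : M.N) : ∃ b a, Base n b a := by
  obtain ⟨b, hb0, hb⟩ := induction_S1
    (P := fun n : M.N => ∃ b, 0 < b ∧ ∀ i < n, ∃ q < b + 1, b = (i + 1) * q)
    (.ex (.of_D0 (by repeat' constructor)))
    ⟨1, one_pos, fun i hi => (RCA.not_lt_zero i hi).elim⟩ (fun n ⟨b, hb0, hb⟩ => by
      have hn : 0 < n + 1 := lt_of_le_of_lt (RCA.zero_le n) (lt_add_one n)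
      refine ⟨b * (n + 1), mul_pos hb0 hn, fun i hi => ?_⟩
      rcases (RCA.lt_add_one_iff.1 hi).lt_or_eq with hi | rfl
      · obtain ⟨q, hq, h⟩ := hb i hi
        refine ⟨q * (n + 1), RCA.lt_add_one_iff.2 (mul_le_mul_left (RCA.lt_add_one_iff.1 hq) _), ?_⟩
        rw [← _root_.mul_assoc, ← h]
      · refine ⟨b, RCA.lt_add_one_iff.2 ?_, _root_.mul_comm _ _⟩
        rw [_root_.mul_add, _root_.mul_one]
        exact le_add_self) n
  obtain ⟨a, ha0, ha⟩ := induction_S1 (P := fun m : M.N => ∃ a, 0 < a ∧ ∀ i < m, InCode b a i)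
    (.ex (.of_D0 (.and (by repeat' constructor) (.ball (.var 1) (InCode.D0 (.const b) (.var 1)
      (.var 0))))))
    ⟨1, one_pos, fun i hi => (RCA.not_lt_zero i hi).elim⟩ (fun m ⟨a, ha0, ha⟩ => by
      refine ⟨a * modulus b m, mul_pos ha0 (modulus_pos _ _), fun i hi => inCode_iff.2 ?_⟩
      rcases (RCA.lt_add_one_iff.1 hi).lt_or_eq with hi | rfl
      · exact (inCode_iff.1 (ha i hi)).mul_right _
      · exact dvd_mul_left _ _) n
  exact ⟨b, a, ha0, hb0, hb, ha⟩

/-- Distinct moduli are coprime. -/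
theorem modulus_coprime {n b i j a : M.N} (hb : ∀ i < n, ∃ q < b + 1, b = (i + 1) * q) (hi : i < n)
    (hj : j < n) (hij : i ≠ j) (h : modulus b i ∣ modulus b j * a) : modulus b i ∣ a := by
  have key : ∀ k < n, modulus b i ∣ (k + 1) * b * a → modulus b i ∣ a := by
    intro k hk h
    obtain ⟨q, -, hq⟩ := hb k hk
    have h1 : modulus b i ∣ (k + 1) * a := by
      refine dvd_of_dvd_add (modulus_pos _ _) (y := (i + 1) * ((k + 1) * b * a)) ?_ (h.mul_left _)
      exact ⟨(k + 1) * a, by simp only [modulus]; ring⟩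
    have h2 : modulus b i ∣ b * a := by
      have := h1.mul_left q
      rwa [← _root_.mul_assoc, _root_.mul_comm q, ← hq] at this
    exact dvd_of_dvd_add (modulus_pos _ _) (y := (i + 1) * (b * a))
      ⟨a, by simp only [modulus]; ring⟩ (h2.mul_left _)
  rcases lt_or_gt_of_ne hij with hij | hij
  · obtain ⟨d, rfl⟩ := RCA.exists_add_of_le hij.le
    obtain ⟨k, rfl⟩ := exists_eq_succ (pos_of_lt_add_right hij)
    refine key k (lt_of_lt_of_le (lt_add_one k) (le_add_self.trans hj.le)) ?_
    refine dvd_of_dvd_add (modulus_pos _ _) (y := modulus b i * a) ?_ (dvd_mul_right _ _)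
    convert h using 1
    simp only [modulus]; ring
  · obtain ⟨d, rfl⟩ := RCA.exists_add_of_le hij.le
    obtain ⟨k, rfl⟩ := exists_eq_succ (pos_of_lt_add_right hij)
    refine key k (lt_of_lt_of_le (lt_add_one k) (le_add_self.trans hi.le)) ?_
    refine dvd_of_dvd_add (modulus_pos _ _) (y := modulus b j * a) ?_ h
    exact ⟨a, by simp only [modulus]; ring⟩

/-- Bounded `Σ⁰₁` sets have codes. -/
theorem Base.exists_code {n b a₀ : M.N} (hB : Base n b a₀) {R : M.N → Prop}
    (hR : S1 fun e : ℕ → M.N => R (e 0)) : ∃ a ≤ a₀, ∀ i < n, InCode b a i ↔ R i := by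
  obtain ⟨ha0, hb0, hb, ha⟩ := hB
  obtain ⟨a, ⟨ha1, ha2⟩, hmin⟩ := exists_least (R := fun a => 0 < a ∧ ∀ i < n, R i → InCode b a i)
    (by
      obtain ⟨Q, hQ, h⟩ := hR
      have hsat : ∀ y, R y ↔ ∃ z, Q (fun _ => y) z := fun y => h fun _ => y
      have : (fun e : ℕ → M.N => ¬(0 < e 0 ∧ ∀ i < n, R i → InCode b (e 0) i)) =
          fun e => ∃ i, ∃ z, 0 < e 0 → i < n ∧ Q (fun _ => i) z ∧ ¬InCode b (e 0) i := by
        funext e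
        simp only [hsat]
        refine propext ⟨fun h => ?_, ?_⟩
        · by_cases h0 : 0 < e 0
          · push Not at h
            obtain ⟨i, hi, ⟨z, hz⟩, h⟩ := h h0
            exact ⟨i, z, fun _ => ⟨hi, hz, h⟩⟩
          · exact ⟨0, 0, fun h => (h0 h).elim⟩
        · rintro ⟨i, z, h⟩ ⟨h0, h'⟩
          obtain ⟨hi, hz, hn⟩ := h h0
          exact hn (h' i hi ⟨z, hz⟩)
      rw [this]
      refine .ex (.ex (.of_D0 (.imp (.lt (.const 0) (.var 2)) (.and (.lt (.var 1) (.const n))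
        (.and (hQ.subst (σ := scons (fun e => e 0) fun _ e => e 1) fun i => ?_)
          (.not (InCode.D0 (.const b) (.var 2) (.var 1))))))))
      cases i
      exacts [.var 0, .var 1])
    ⟨a₀, ha0, fun i hi _ => ha i hi⟩
  refine ⟨a, not_lt.1 fun h => hmin a₀ h ⟨ha0, fun i hi _ => ha i hi⟩, fun j hj =>
    ⟨fun hja => ?_, ha2 j hj⟩⟩
  by_contra hRj
  obtain ⟨a', rfl⟩ := inCode_iff.1 hja
  have ha' : 0 < a' := pos_of_mul_pos_right ha1 (RCA.zero_le _)
  refine hmin a' ?_ ⟨ha', fun i hi hRi => inCode_iff.2 ?_⟩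
  · exact lt_mul_of_one_lt_left ha' (lt_add_of_pos_right 1
      (mul_pos (lt_of_le_of_lt (RCA.zero_le j) (lt_add_one j)) hb0))
  · exact modulus_coprime hb hi hj (fun h => hRj (h ▸ hRi)) (inCode_iff.1 (ha2 i hi hRi))

/-- Bounded `Σ⁰₁` comprehension. -/
theorem bounded_comprehension {R : M.N → Prop} (hR : S1 fun e : ℕ → M.N => R (e 0)) (n : M.N) :
    ∃ X : M.S, ∀ i, i ∈ X ↔ i < n ∧ R i := by
  obtain ⟨b, a₀, hB⟩ := exists_base n
  obtain ⟨a, -, ha⟩ := hB.exists_code hR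
  obtain ⟨X, hX⟩ := comprehension_D0 (P := fun i => i < n ∧ InCode b a i)
    (.and (.lt (.var 1) (.const n)) (InCode.D0 (.const b) (.const a) (.var 1)))
  exact ⟨X, fun i => (hX i).trans (and_congr_right fun hi => ha i hi)⟩

/-- Strong collection for bounded-quantifier formulas. -/
theorem strong_collection {R : M.N → M.N → Prop} (hR : D0 fun e : ℕ → M.N => R (e 0) (e 1))
    (a : M.N) : ∃ b, ∀ x < a, ∀ y, R x y → ∃ y < b, R x y := by
  obtain ⟨X, hX⟩ := bounded_comprehension (R := fun x => ∃ y, R x y)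
    (.ex (.of_D0 (hR.app₂ (.var 1) (.var 0)))) a
  obtain ⟨b, hb⟩ := collection (R := fun x y => x ∈ X → R x y)
    (.imp (.mem X (.var 0)) hR) a fun x hx => by
      by_cases h : x ∈ X
      · exact ((hX x).1 h).2.imp fun _ h _ => h
      · exact ⟨0, fun h' => (h h').elim⟩
  refine ⟨b, fun x hx y hy => ?_⟩
  obtain ⟨z, hz, h⟩ := hb x hx
  exact ⟨z, hz, h ((hX x).2 ⟨hx, y, hy⟩)⟩

/-- An unbounded `Σ⁰₁` class has an unbounded subset. -/
theorem exists_unbounded_subset {E : M.N → M.N → Prop} (hE : D0 fun e : ℕ → M.N => E (e 0) (e 1))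
    (hle : ∀ y n, E y n → y ≤ n) (h : ∀ b, ∃ y, b ≤ y ∧ ∃ n, E y n) :
    ∃ H : M.S, (∀ y ∈ H, ∃ n, E y n) ∧ ∀ b, ∃ y ∈ H, b ≤ y := by
  let C : M.N → M.N → Prop := fun y n => E y n ∧ ∀ m < n, ∀ y' < m + 1, E y' m → y' < y
  have hC : D0 fun e : ℕ → M.N => C (e 0) (e 1) :=
    .and hE (.ball (.var 1) (.ball (.add (.var 0) (.const 1)) (.imp (hE.app₂ (.var 0) (.var 1))
      (.lt (.var 0) (.var 2)))))
  obtain ⟨H, hH⟩ := comprehension_delta (P := fun y => ∃ n, C y n)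
    (.ex (.of_D0 (hC.app₂ (.var 1) (.var 0)))) (by
      have : (fun e : ℕ → M.N => ¬∃ n, C (e 0) n) =
          fun e => ∃ n, ∃ y' < n + 1, E y' n ∧ e 0 < y' ∧ ∀ m < n + 1, ¬C (e 0) m := by
        funext e
        refine propext ⟨fun hn => ?_, ?_⟩
        · obtain ⟨y', hy', n, hE'⟩ := h (e 0 + 1)
          exact ⟨n, y', RCA.lt_add_one_iff.2 (hle _ _ hE'), hE', lt_of_lt_of_le (lt_add_one _) hy',
            fun m _ hm => hn ⟨m, hm⟩⟩
        · rintro ⟨n, y', hy', hE', hlt, hn⟩ ⟨m, hm⟩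
          by_cases hmn : m < n + 1
          · exact hn m hmn hm
          · exact lt_asymm hlt (hm.2 n (lt_of_lt_of_le (lt_add_one n) (not_lt.1 hmn)) y' hy' hE')
      rw [this]
      exact .ex (.of_D0 (.bex (.add (.var 0) (.const 1)) (.and (hE.app₂ (.var 0) (.var 1))
        (.and (.lt (.var 2) (.var 0)) (.ball (.add (.var 1) (.const 1))
          (.not (hC.app₂ (.var 3) (.var 0)))))))))
  refine ⟨H, fun y hy => ((hH y).1 hy).imp fun _ h => h.1, fun b => ?_⟩
  obtain ⟨n, ⟨y, hy, hby, hE'⟩, hmin⟩ := exists_least_D0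
    (R := fun n => ∃ y < n + 1, b ≤ y ∧ E y n)
    (.bex (.add (.var 0) (.const 1)) (.and (.le (.const b) (.var 0)) (hE.app₂ (.var 0) (.var 1))))
    (by
      obtain ⟨y, hy, n, hE'⟩ := h b
      exact ⟨n, y, RCA.lt_add_one_iff.2 (hle _ _ hE'), hy, hE'⟩)
  refine ⟨y, (hH y).2 ⟨n, hE', fun m hm y' hy' h' => ?_⟩, hby⟩
  exact lt_of_lt_of_le (not_le.1 fun hb => hmin m hm ⟨y', hy', hb, h'⟩) hby

end SOA

namespace SOA

/-! ### Pairs and triples -/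

section

variable {M : Str}

/-- The code of the ordered pair `(x, y)`. -/
abbrev npair (x y : M.N) : M.N := (x + y) * (x + y) + x

/-- The code of the triple `(x, y, z)`. -/
abbrev triple (x y z : M.N) : M.N := npair x (npair y z)

variable [RCA M]

theorem le_mul_self (x : M.N) : x ≤ x * x := by
  rcases (RCA.zero_le x).eq_or_lt with rfl | h
  · rw [zero_mul]
  · obtain ⟨y, rfl⟩ := RCA.exists_eq_succ h
    rw [add_mul, one_mul]
    exact le_add_self

theorem left_le_npair (x y : M.N) : x ≤ npair x y := le_add_self

theorem right_le_npair (x y : M.N) : y ≤ npair x y :=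
  (le_add_self.trans (le_mul_self (x + y))).trans le_self_add

theorem npair_lt_npair {x y x' y' : M.N} (h : x + y < x' + y') : npair x y < npair x' y' := by
  refine lt_of_lt_of_le (b := (x + y + 1) * (x + y + 1)) ?_ ((mul_le_mul' ?_ ?_).trans le_self_add)
  · refine RCA.lt_add_one_iff.2 ?_ |>.trans_le (b := (x + y) * (x + y) + (x + y) + 1) ?_
    · exact add_le_add_right le_self_add _
    · have : (x + y + 1) * (x + y + 1) = (x + y) * (x + y) + (x + y) + 1 + (x + y) := by ring
      rw [this]
      exact le_self_add
  all_goals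
    obtain ⟨c, hc⟩ := RCA.exists_add_of_le h.le
    rw [hc] at h ⊢
    obtain ⟨d, rfl⟩ := RCA.exists_eq_succ (pos_of_lt_add_right h)
    exact add_le_add_right le_add_self _

theorem npair_inj {x y x' y' : M.N} : npair x y = npair x' y' ↔ x = x' ∧ y = y' := by
  refine ⟨fun h => ?_, fun ⟨h, h'⟩ => by rw [h, h']⟩
  have hs : x + y = x' + y' := by
    rcases lt_trichotomy (x + y) (x' + y') with h' | h' | h'
    exacts [absurd h (npair_lt_npair h').ne, h', absurd h (npair_lt_npair h').ne']
  have hx : x = x' := by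
    simp only [npair, hs] at h
    exact add_left_cancel h
  subst hx
  exact ⟨rfl, add_left_cancel hs⟩

theorem triple_inj {x y z x' y' z' : M.N} :
    triple x y z = triple x' y' z' ↔ x = x' ∧ y = y' ∧ z = z' := by
  rw [triple, triple, npair_inj, npair_inj]

theorem fst_lt_triple (x y z : M.N) : x < triple x y z + 1 :=
  RCA.lt_add_one_iff.2 (left_le_npair _ _)

theorem snd_lt_triple (x y z : M.N) : y < triple x y z + 1 :=
  RCA.lt_add_one_iff.2 ((left_le_npair _ _).trans (right_le_npair _ _))

theorem trd_lt_triple (x y z : M.N) : z < triple x y z + 1 :=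
  RCA.lt_add_one_iff.2 ((right_le_npair _ _).trans (right_le_npair _ _))

end

/-! ### Separated points -/

variable {M : Str}

/-- `F` is a 2-coloring of the part below `s` of the relation `C`. -/
def Colors (C F : M.S) (s : M.N) : Prop :=
  ∀ u < s, ∀ v < s, npair u v ∈ C → ¬(u ∈ F ↔ v ∈ F)

/-- Every 2-coloring of the part of `C` below `s` gives `x` and `y` different colors. -/
def Separated (C : M.S) (s x y : M.N) : Prop :=
  x < s ∧ y < s ∧ ∀ F, Colors C F s → ¬(x ∈ F ↔ y ∈ F)

variable [RCA M] {C : M.S} {s t x y z w : M.N}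

omit [RCA M] in
theorem Separated.symm (h : Separated C s x y) : Separated C s y x :=
  ⟨h.2.1, h.1, fun F hF h' => h.2.2 F hF h'.symm⟩

omit [RCA M] in
theorem Separated.trans (h : Separated C s x y) (h' : Separated C s y z) (h'' : Separated C s z w) :
    Separated C s x w :=
  ⟨h.1, h''.2.1, fun F hF => by
    have := h.2.2 F hF
    have := h'.2.2 F hF
    have := h''.2.2 F hF
    tauto⟩

theorem Colors.mono {F : M.S} (h : Colors C F t) (hst : s ≤ t) : Colors C F s :=
  fun u hu v hv => h u (hu.trans_le hst) v (hv.trans_le hst)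

theorem Separated.mono (h : Separated C s x y) (hst : s ≤ t) : Separated C t x y :=
  ⟨h.1.trans_le hst, h.2.1.trans_le hst, fun F hF => h.2.2 F (hF.mono hst)⟩

/-- A code for a 2-coloring of `C` below `s`. -/
def ColorsCode (C : M.S) (b a s : M.N) : Prop :=
  ∀ u < s, ∀ v < s, npair u v ∈ C → ¬(InCode b a u ↔ InCode b a v)

omit [RCA M] in
theorem ColorsCode.D0 {f g h : (ℕ → M.N) → M.N} (hf : TermFn f) (hg : TermFn g) (hh : TermFn h) :
    D0 fun e => ColorsCode C (f e) (g e) (h e) := by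
  have ht : ∀ {t : (ℕ → M.N) → M.N}, TermFn t → TermFn fun e => t (tail e) :=
    fun ht => ht.subst fun i => .var (i + 1)
  exact .ball hh (.ball (ht hh) (.imp (.mem C (by repeat' constructor)) (.not (.iff
    (InCode.D0 (ht (ht hf)) (ht (ht hg)) (.var 1)) (InCode.D0 (ht (ht hf)) (ht (ht hg)) (.var 0))))))

omit [RCA M] in
theorem Base.D0 {f g h : (ℕ → M.N) → M.N} (hf : TermFn f) (hg : TermFn g) (hh : TermFn h) :
    D0 fun e => Base (f e) (g e) (h e) := by
  have ht : ∀ {t : (ℕ → M.N) → M.N}, TermFn t → TermFn fun e => t (tail e) :=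
    fun ht => ht.subst fun i => .var (i + 1)
  exact .and (.lt (.const 0) hh) (.and (.lt (.const 0) hg) (.and (.ball hf
    (.bex (.add (ht hg) (.const 1)) (.eq (ht (ht hg)) (by repeat' constructor))))
    (.ball hf (InCode.D0 (ht hg) (ht hh) (.var 0)))))

theorem separated_iff_forall_code : Separated C s x y ↔ x < s ∧ y < s ∧
    ∀ b a, ColorsCode C b a s → ¬(InCode b a x ↔ InCode b a y) := by
  refine and_congr_right fun hx => and_congr_right fun hy => ⟨fun h b a hc => ?_, fun h F hF => ?_⟩
  · obtain ⟨F, hF⟩ := comprehension_D0 (P := fun i => InCode b a i)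
      (InCode.D0 (.const b) (.const a) (.var 1))
    rw [← hF, ← hF]
    refine h F fun u hu v hv huv => ?_
    rw [hF, hF]
    exact hc u hu v hv huv
  · obtain ⟨b, a₀, hB⟩ := exists_base s
    obtain ⟨a, -, ha⟩ := hB.exists_code (R := fun i => i ∈ F) (.of_D0 (.mem F (.var 0)))
    rw [← ha x hx, ← ha y hy]
    refine h b a fun u hu v hv huv => ?_
    rw [ha u hu, ha v hv]
    exact hF u hu v hv huv

theorem separated_iff_exists_base : Separated C s x y ↔ x < s ∧ y < s ∧ ∃ b a₀, Base s b a₀ ∧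
    ∀ a < a₀ + 1, ColorsCode C b a s → ¬(InCode b a x ↔ InCode b a y) := by
  constructor
  · intro h
    obtain ⟨b, a₀, hB⟩ := exists_base s
    exact ⟨h.1, h.2.1, b, a₀, hB, fun a _ => (separated_iff_forall_code.1 h).2.2 b a⟩
  · rintro ⟨hx, hy, b, a₀, hB, h⟩
    refine ⟨hx, hy, fun F hF => ?_⟩
    obtain ⟨a, ha', ha⟩ := hB.exists_code (R := fun i => i ∈ F) (.of_D0 (.mem F (.var 0)))
    rw [← ha x hx, ← ha y hy]
    refine h a (RCA.lt_add_one_iff.2 ha') fun u hu v hv huv => ?_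
    rw [ha u hu, ha v hv]
    exact hF u hu v hv huv

/-- The relation `Separated C` is given by a set. -/
theorem exists_separated_set (C : M.S) :
    ∃ D : M.S, ∀ s x y, triple s x y ∈ D ↔ Separated C s x y := by
  have hS : S1 fun e : ℕ → M.N => ∃ s x y, e 0 = triple s x y ∧ Separated C s x y := by
    have : (fun e : ℕ → M.N => ∃ s x y, e 0 = triple s x y ∧ Separated C s x y) = fun e =>
        ∃ s x y b a₀, e 0 = triple s x y ∧ x < s ∧ y < s ∧ Base s b a₀ ∧
          ∀ a < a₀ + 1, ColorsCode C b a s → ¬(InCode b a x ↔ InCode b a y) := by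
      funext e
      simp only [separated_iff_exists_base, exists_and_left]
    rw [this]
    exact .ex <| .ex <| .ex <| .ex <| .ex <| .of_D0 <| .and (by repeat' constructor) <|
      .and (.lt (.var 3) (.var 4)) <| .and (.lt (.var 2) (.var 4)) <|
      .and (Base.D0 (.var 4) (.var 1) (.var 0)) <| .ball (.add (.var 0) (.const 1)) <|
      .imp (ColorsCode.D0 (.var 2) (.var 0) (.var 5)) <| .not <|
      .iff (InCode.D0 (.var 2) (.var 0) (.var 4)) (InCode.D0 (.var 2) (.var 0) (.var 3))
  have hS' : S1 fun e : ℕ → M.N => ¬∃ s x y, e 0 = triple s x y ∧ Separated C s x y := by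
    have : (fun e : ℕ → M.N => ¬∃ s x y, e 0 = triple s x y ∧ Separated C s x y) = fun e =>
        ∃ s x y b a, (∀ s < e 0 + 1, ∀ x < e 0 + 1, ∀ y < e 0 + 1, ¬e 0 = triple s x y) ∨
          e 0 = triple s x y ∧ (¬(x < s ∧ y < s) ∨
            ColorsCode C b a s ∧ (InCode b a x ↔ InCode b a y)) := by
      funext e
      refine propext ⟨fun hn => ?_, ?_⟩
      · by_cases h : ∃ s x y, e 0 = triple s x y
        · obtain ⟨s, x, y, h⟩ := h
          have h' : ¬Separated C s x y := fun h' => hn ⟨s, x, y, h, h'⟩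
          rw [separated_iff_forall_code] at h'
          by_cases hs : x < s ∧ y < s
          · have : ¬∀ b a, ColorsCode C b a s → ¬(InCode b a x ↔ InCode b a y) :=
              fun h => h' ⟨hs.1, hs.2, h⟩
            push Not at this
            obtain ⟨b, a, h1, h2⟩ := this
            exact ⟨s, x, y, b, a, .inr ⟨h, .inr ⟨h1, h2⟩⟩⟩
          · exact ⟨s, x, y, 0, 0, .inr ⟨h, .inl hs⟩⟩
        · exact ⟨0, 0, 0, 0, 0, .inl fun s _ x _ y _ h' => h ⟨s, x, y, h'⟩⟩
      · rintro ⟨s, x, y, b, a, h⟩ ⟨s', x', y', h1, h2⟩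
        rcases h with h | ⟨h, h'⟩
        · rw [h1] at h
          exact h s' (fst_lt_triple _ _ _) x' (snd_lt_triple _ _ _) y' (trd_lt_triple _ _ _) rfl
        · rw [h1] at h
          obtain ⟨rfl, rfl, rfl⟩ := triple_inj.1 h
          rw [separated_iff_forall_code] at h2
          rcases h' with h' | ⟨h', h''⟩
          exacts [h' ⟨h2.1, h2.2.1⟩, h2.2.2 b a h' h'']
    rw [this]
    refine .ex <| .ex <| .ex <| .ex <| .ex <| .of_D0 <| .or (by repeat' constructor) <|
      .and (by repeat' constructor) <| .or (by repeat' constructor) <|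
      .and (ColorsCode.D0 (.var 1) (.var 0) (.var 4)) <|
      .iff (InCode.D0 (.var 1) (.var 0) (.var 3)) (InCode.D0 (.var 1) (.var 0) (.var 2))
  obtain ⟨D, hD⟩ := comprehension_delta
    (P := fun n => ∃ s x y, n = triple s x y ∧ Separated C s x y) hS hS'
  refine ⟨D, fun s x y => (hD _).trans ⟨?_, fun h => ⟨s, x, y, rfl, h⟩⟩⟩
  rintro ⟨s', x', y', h, h'⟩
  obtain ⟨rfl, rfl, rfl⟩ := triple_inj.1 h
  exact h'

/-- If no two points of `H` are separated, then all of `H` can get the color `0`. -/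
theorem exists_coloring_of_not_separated {H : M.S}
    (hH : ∀ x ∈ H, ∀ y ∈ H, ¬Separated C s x y) (hC : ∃ F, Colors C F s) :
    ∃ F, Colors C F s ∧ ∀ x ∈ H, x ∉ F := by
  obtain ⟨D, hD⟩ := exists_separated_set C
  obtain ⟨F, hF⟩ := hC
  obtain ⟨G, hG⟩ := comprehension_D0 (P := fun v => v < s ∧
    ((∃ h < s, h ∈ H ∧ triple s v h ∈ D) ∨ v ∈ F ∧ ¬(v ∈ H ∨
      ∃ u < s, triple s v u ∈ D ∧ ∃ h < s, h ∈ H ∧ triple s u h ∈ D))) (by repeat' constructor)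
  simp only [hD] at hG
  have hadj : ∀ u < s, ∀ v < s, npair u v ∈ C → Separated C s u v := fun u hu v hv huv =>
    ⟨hu, hv, fun F hF => hF u hu v hv huv⟩
  have hone : ∀ u v, Separated C s u v → (∃ h < s, h ∈ H ∧ Separated C s u h) → u ∈ G ∧ v ∉ G := by
    rintro u v huv ⟨h, hs, hh, hu⟩
    refine ⟨(hG u).2 ⟨huv.1, .inl ⟨h, hs, hh, hu⟩⟩, fun hv => ?_⟩
    rcases ((hG v).1 hv).2 with ⟨h', -, hh', hv'⟩ | ⟨-, hv'⟩
    · exact hH h hh h' hh' (hu.symm.trans huv hv')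
    · exact hv' (.inr ⟨u, huv.1, huv.symm, h, hs, hh, hu⟩)
  have htwo : ∀ u v, Separated C s u v → (¬∃ h < s, h ∈ H ∧ Separated C s u h) →
      (¬∃ h < s, h ∈ H ∧ Separated C s v h) → (u ∈ G ↔ u ∈ F) := by
    intro u v huv hu hv
    rw [hG]
    refine ⟨fun h => (h.2.resolve_left hu).1, fun h => ⟨huv.1, .inr ⟨h, ?_⟩⟩⟩
    rintro (h | ⟨w, -, huw, h, hs, hh, hw⟩)
    · exact hv ⟨u, huv.1, h, huv.symm⟩
    · exact hv ⟨h, hs, hh, huv.symm.trans huw hw⟩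
  refine ⟨G, fun u hu v hv huv => ?_, fun x hx hxG => ?_⟩
  · have huv' := hadj u hu v hv huv
    by_cases h1 : ∃ h < s, h ∈ H ∧ Separated C s u h
    · have := hone u v huv' h1
      tauto
    by_cases h2 : ∃ h < s, h ∈ H ∧ Separated C s v h
    · have := hone v u huv'.symm h2
      tauto
    rw [htwo u v huv' h1 h2, htwo v u huv'.symm h2 h1]
    exact hF u hu v hv huv
  · rcases ((hG x).1 hxG).2 with ⟨h, -, hh, hx'⟩ | ⟨-, h⟩
    exacts [hH x hx h hh hx', h (.inl hx)]

end SOA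

namespace SOA

/-! ### The meaning of the formulas -/

section

variable {M : Str}

/-- `X` is finite, that is, bounded. -/
def Bdd (X : M.S) : Prop := ∃ b, ∀ x ∈ X, x < b

/-- `E` is a relation on `V`. -/
def RelOn (V E : M.S) : Prop := ∀ n ∈ E, ∃ x y, x ∈ V ∧ y ∈ V ∧ n = npair x y

/-- `(V, E)` is a graph. -/
def IsGraph (V E : M.S) : Prop :=
  RelOn V E ∧ (∀ x y, npair x y ∈ E → npair y x ∈ E) ∧ ∀ x, npair x x ∉ E

/-- `F` colors the subgraph induced by `V`. -/
def Coloring (V E F : M.S) : Prop :=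
  ∀ x y, x ∈ V ∧ y ∈ V ∧ npair x y ∈ E → ¬(x ∈ F ↔ y ∈ F)

/-- `(V, E)` is finitely colorable. -/
def FinitelyColorable (V E : M.S) : Prop :=
  ∀ V₀ : M.S, Bdd V₀ ∧ (∀ x ∈ V₀, x ∈ V) → ∃ F, Coloring V₀ E F

/-- `H` is homogeneous for `(V, E)`. -/
def HomogeneousGraph (V E H : M.S) : Prop :=
  ∀ V₀ : M.S, Bdd V₀ ∧ (∀ x ∈ V₀, x ∈ V) → ∃ F, Coloring V₀ E F ∧ ∀ x, x ∈ V₀ ∧ x ∈ H → x ∉ F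

/-- The assignment `F` satisfies the formulas in `C`. -/
def Satisfies (F C : M.S) : Prop := ∀ x y, npair x y ∈ C → ¬(x ∈ F ↔ y ∈ F)

/-- `C` is finitely satisfiable. -/
def FinitelySatisfiable (C : M.S) : Prop :=
  ∀ C₀ : M.S, Bdd C₀ ∧ (∀ x ∈ C₀, x ∈ C) → ∃ F, Satisfies F C₀

/-- `H` is homogeneous for `C`. -/
def HomogeneousFml (C H : M.S) : Prop :=
  (∀ C₀ : M.S, Bdd C₀ ∧ (∀ x ∈ C₀, x ∈ C) → ∃ F, Satisfies F C₀ ∧ ∀ x ∈ H, x ∈ F) ∨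
    ∀ C₀ : M.S, Bdd C₀ ∧ (∀ x ∈ C₀, x ∈ C) → ∃ F, Satisfies F C₀ ∧ ∀ x ∈ H, x ∉ F

variable (M) in
/-- `RCOLOR₂` in `M`. -/
def Rcolor : Prop := ∀ V E : M.S, IsGraph V E ∧ ¬Bdd V ∧ FinitelyColorable V E →
  ∃ H : M.S, (∀ x ∈ H, x ∈ V) ∧ ¬Bdd H ∧ HomogeneousGraph V E H

variable (M) in
/-- `LRSAT([x ≠ y])` in `M`. -/
def Lrsat : Prop := ∀ V C : M.S, ¬Bdd V ∧ RelOn V C ∧ FinitelySatisfiable C →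
  ∀ L : M.S, (∀ x ∈ L, x ∈ V) ∧ ¬Bdd L →
    ∃ H : M.S, (∀ x ∈ H, x ∈ L) ∧ ¬Bdd H ∧ HomogeneousFml C H

variable (e : ℕ → M.N) (s : ℕ → M.S)

@[simp] theorem scons_one {α : Type} (a : α) (f : ℕ → α) : scons a f 1 = f 0 := rfl

@[simp] theorem scons_two {α : Type} (a : α) (f : ℕ → α) : scons a f 2 = f 1 := rfl

theorem eval_pair (t u : Tm) : (pair t u).eval e = npair (t.eval e) (u.eval e) := rfl

theorem sat_finite (X : ℕ) : (finite X).sat e s ↔ Bdd (s X) := by simp [finite, Bdd]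

theorem sat_subset (X Y : ℕ) : (subset X Y).sat e s ↔ ∀ x ∈ s X, x ∈ s Y := by simp [subset]

theorem sat_relOn (V E : ℕ) : (relOn V E).sat e s ↔ RelOn (s V) (s E) := by
  simp [relOn, RelOn, eval_pair]

theorem sat_isGraph (V E : ℕ) : (isGraph V E).sat e s ↔ IsGraph (s V) (s E) := by
  simp [isGraph, IsGraph, eval_pair, sat_relOn]

theorem sat_coloring (V E F : ℕ) : (coloring V E F).sat e s ↔ Coloring (s V) (s E) (s F) := by
  simp [coloring, Coloring, eval_pair]

theorem sat_finitelyColorable (V E : ℕ) :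
    (finitelyColorable V E).sat e s ↔ FinitelyColorable (s V) (s E) := by
  simp [finitelyColorable, FinitelyColorable, sat_finite, sat_subset, sat_coloring]

theorem sat_homogeneousGraph (V E H : ℕ) :
    (homogeneousGraph V E H).sat e s ↔ HomogeneousGraph (s V) (s E) (s H) := by
  simp [homogeneousGraph, HomogeneousGraph, sat_finite, sat_subset, sat_coloring]

theorem sat_satisfies (F C : ℕ) : (satisfies F C).sat e s ↔ Satisfies (s F) (s C) := by
  simp [satisfies, Satisfies, eval_pair]

theorem sat_finitelySatisfiable (C : ℕ) :
    (finitelySatisfiable C).sat e s ↔ FinitelySatisfiable (s C) := by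
  simp [finitelySatisfiable, FinitelySatisfiable, sat_finite, sat_subset, sat_satisfies]

theorem sat_homogeneousFml (C H : ℕ) :
    (homogeneousFml C H).sat e s ↔ HomogeneousFml (s C) (s H) := by
  simp [homogeneousFml, HomogeneousFml, sat_finite, sat_subset, sat_satisfies]

theorem sat_RCOLOR2 : RCOLOR2.sat e s ↔ Rcolor M := by
  simp [RCOLOR2, Rcolor, infinite, sat_finite, sat_subset, sat_isGraph, sat_finitelyColorable,
    sat_homogeneousGraph]

theorem sat_LRSATneq : LRSATneq.sat e s ↔ Lrsat M := by
  simp [LRSATneq, Lrsat, infinite, sat_finite, sat_subset, sat_relOn, sat_finitelySatisfiable,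
    sat_homogeneousFml]

end

variable {M : Str} [RCA M]

theorem not_bdd_iff {X : M.S} : ¬Bdd X ↔ ∀ b, ∃ x ∈ X, b ≤ x := by
  simp [Bdd]

/-! ### `LRSAT([x ≠ y])` implies `RCOLOR₂` -/

theorem lt_of_npair_lt {x y b : M.N} (h : npair x y < b) : x < b ∧ y < b :=
  ⟨(left_le_npair x y).trans_lt h, (right_le_npair x y).trans_lt h⟩

theorem npair_le_npair {x y x' y' : M.N} (hx : x ≤ x') (hy : y ≤ y') : npair x y ≤ npair x' y' :=
  add_le_add (mul_le_mul' (add_le_add hx hy) (add_le_add hx hy)) hx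

theorem Lrsat.rcolor (h : Lrsat M) : Rcolor M := by
  rintro V E ⟨⟨hrel, hsymm, -⟩, hV, hcol⟩
  obtain ⟨H, hHV, hHb, hH⟩ := h V E ⟨hV, hrel, fun C₀ ⟨⟨b, hb⟩, hC₀⟩ => by
    obtain ⟨V₀, hV₀⟩ := comprehension_D0 (P := fun x => x ∈ V ∧ x < b) (by repeat' constructor)
    obtain ⟨F, hF⟩ := hcol V₀ ⟨⟨b, fun x hx => ((hV₀ x).1 hx).2⟩, fun x hx => ((hV₀ x).1 hx).1⟩
    refine ⟨F, fun x y hxy => hF x y ?_⟩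
    obtain ⟨x', y', hx', hy', he⟩ := hrel _ (hC₀ _ hxy)
    obtain ⟨rfl, rfl⟩ := npair_inj.1 he
    have := lt_of_npair_lt (hb _ hxy)
    exact ⟨(hV₀ _).2 ⟨hx', this.1⟩, (hV₀ _).2 ⟨hy', this.2⟩, hC₀ _ hxy⟩⟩ V ⟨fun _ h => h, hV⟩
  refine ⟨H, hHV, hHb, fun V₀ ⟨⟨b, hb⟩, hV₀⟩ => ?_⟩
  obtain ⟨C₀, hC₀⟩ := comprehension_D0
    (P := fun n => n ∈ E ∧ ∃ x < b, ∃ y < b, x ∈ V₀ ∧ y ∈ V₀ ∧ n = npair x y)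
    (by repeat' constructor)
  have hfin : Bdd C₀ ∧ ∀ x ∈ C₀, x ∈ E := by
    refine ⟨⟨npair b b + 1, fun n hn => ?_⟩, fun n hn => ((hC₀ n).1 hn).1⟩
    obtain ⟨-, x, hx, y, hy, -, -, rfl⟩ := (hC₀ n).1 hn
    exact RCA.lt_add_one_iff.2 (npair_le_npair hx.le hy.le)
  have hedge : ∀ x y, x ∈ V₀ ∧ y ∈ V₀ ∧ npair x y ∈ E → npair x y ∈ C₀ := fun x y ⟨hx, hy, hxy⟩ =>
    (hC₀ _).2 ⟨hxy, x, hb x hx, y, hb y hy, hx, hy, rfl⟩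
  rcases hH with hH | hH
  · obtain ⟨F, hF, hF'⟩ := hH C₀ hfin
    obtain ⟨G, hG⟩ := comprehension_D0 (P := fun x => x ∉ F) (.not (.mem F (.var 1)))
    refine ⟨G, fun x y hxy => ?_, fun x hx => ?_⟩
    · rw [hG, hG, not_iff_not]
      exact hF x y (hedge x y hxy)
    · rw [hG, not_not]
      exact hF' x hx.2
  · obtain ⟨F, hF, hF'⟩ := hH C₀ hfin
    exact ⟨F, fun x y hxy => hF x y (hedge x y hxy), fun x hx => hF' x hx.2⟩

/-! ### `RCOLOR₂` implies `LRSAT([x ≠ y])` -/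

theorem FinitelySatisfiable.exists_colors {C : M.S} (h : FinitelySatisfiable C) (s : M.N) :
    ∃ F, Colors C F s := by
  obtain ⟨C₀, hC₀⟩ := comprehension_D0 (P := fun n => n ∈ C ∧ n < npair s s + 1)
    (.and (.mem C (.var 1)) (.lt (.var 1) (.const _)))
  obtain ⟨F, hF⟩ := h C₀ ⟨⟨_, fun n hn => ((hC₀ n).1 hn).2⟩, fun n hn => ((hC₀ n).1 hn).1⟩
  exact ⟨F, fun u hu v hv huv =>
    hF u v ((hC₀ _).2 ⟨huv, RCA.lt_add_one_iff.2 (npair_le_npair hu.le hv.le)⟩)⟩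

theorem homogeneousFml_of_not_separated {C H : M.S} (hC : FinitelySatisfiable C)
    (hH : ∀ s, ∀ x ∈ H, ∀ y ∈ H, ¬Separated C s x y) : HomogeneousFml C H := by
  refine .inr fun C₀ ⟨⟨b, hb⟩, hC₀⟩ => ?_
  obtain ⟨F, hF, hF'⟩ := exists_coloring_of_not_separated (hH b) (hC.exists_colors b)
  refine ⟨F, fun x y hxy => ?_, hF'⟩
  have := lt_of_npair_lt (hb _ hxy)
  exact hF x this.1 y this.2 (hC₀ _ hxy)

/-- `s` is the first stage at which `x` and `y` are separated; also, `(x, x, 0)` is an event. -/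
def Event (C : M.S) (x y s : M.N) : Prop :=
  s = 0 ∧ y = x ∨ Separated C s x y ∧ ∀ t < s, ¬Separated C t x y

theorem Separated.exists_event {C : M.S} {s x y : M.N} (h : Separated C s x y) :
    ∃ u ≤ s, Separated C u x y ∧ Event C x y u ∧ Event C y x u := by
  obtain ⟨D, hD⟩ := exists_separated_set C
  obtain ⟨u, hu, hmin⟩ := exists_least_D0 (R := fun s => triple s x y ∈ D) (by repeat' constructor)
    ⟨s, (hD _ _ _).2 h⟩
  simp only [hD] at hu hmin
  exact ⟨u, not_lt.1 fun hs => hmin s hs h, hu, .inr ⟨hu, hmin⟩,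
    .inr ⟨hu.symm, fun t ht h => hmin t ht h.symm⟩⟩

/-- The set of events over `L`. -/
theorem exists_event_set (C L : M.S) :
    ∃ V : M.S, ∀ n, n ∈ V ↔ ∃ x y s, n = triple x y s ∧ x ∈ L ∧ y ∈ L ∧ Event C x y s := by
  obtain ⟨D, hD⟩ := exists_separated_set C
  obtain ⟨V, hV⟩ := comprehension_D0 (P := fun n => ∃ x < n + 1, ∃ y < n + 1, ∃ s < n + 1,
    n = triple x y s ∧ x ∈ L ∧ y ∈ L ∧
      (s = 0 ∧ y = x ∨ triple s x y ∈ D ∧ ∀ t < s, ¬triple t x y ∈ D)) (by repeat' constructor)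
  simp only [hD] at hV
  refine ⟨V, fun n => (hV n).trans ⟨?_, ?_⟩⟩
  · rintro ⟨x, -, y, -, s, -, h⟩
    exact ⟨x, y, s, h⟩
  · rintro ⟨x, y, s, rfl, h⟩
    exact ⟨x, fst_lt_triple _ _ _, y, snd_lt_triple _ _ _, s, trd_lt_triple _ _ _, rfl, h⟩

/-- Two events are adjacent if their first points are separated at one of their stages. -/
theorem exists_event_edges (C V : M.S) : ∃ E : M.S, ∀ n, n ∈ E ↔
    ∃ x y s x' y' s', n = npair (triple x y s) (triple x' y' s') ∧ triple x y s ∈ V ∧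
      triple x' y' s' ∈ V ∧ (Separated C s x x' ∨ Separated C s' x x') := by
  obtain ⟨D, hD⟩ := exists_separated_set C
  obtain ⟨E, hE⟩ := comprehension_D0 (P := fun n => ∃ p < n + 1, ∃ q < n + 1,
    n = npair p q ∧ p ∈ V ∧ q ∈ V ∧
    ∃ x < p + 1, ∃ y < p + 1, ∃ s < p + 1, p = triple x y s ∧
    ∃ x' < q + 1, ∃ y' < q + 1, ∃ s' < q + 1, q = triple x' y' s' ∧
      (triple s x x' ∈ D ∨ triple s' x x' ∈ D)) (by repeat' constructor)
  simp only [hD] at hE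
  refine ⟨E, fun n => (hE n).trans ⟨?_, ?_⟩⟩
  · rintro ⟨_, -, _, -, rfl, hp, hq, x, -, y, -, s, -, rfl, x', -, y', -, s', -, rfl, h⟩
    exact ⟨x, y, s, x', y', s', rfl, hp, hq, h⟩
  · rintro ⟨x, y, s, x', y', s', rfl, hp, hq, h⟩
    exact ⟨_, RCA.lt_add_one_iff.2 (left_le_npair _ _), _, RCA.lt_add_one_iff.2 (right_le_npair _ _),
      rfl, hp, hq, x, fst_lt_triple _ _ _, y, snd_lt_triple _ _ _, s, trd_lt_triple _ _ _, rfl,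
      x', fst_lt_triple _ _ _, y', snd_lt_triple _ _ _, s', trd_lt_triple _ _ _, rfl, h⟩

/-- `RCOLOR₂` gives an unbounded set of events no two of which have separated first points. -/
theorem Rcolor.exists_events (h : Rcolor M) {C L : M.S} (hC : FinitelySatisfiable C)
    (hL : ¬Bdd L) : ∃ H : M.S, ¬Bdd H ∧
      (∀ n ∈ H, ∃ x y s, n = triple x y s ∧ x ∈ L ∧ y ∈ L ∧ Event C x y s) ∧
      ∀ x y s x' y' s', triple x y s ∈ H → triple x' y' s' ∈ H → ∀ u, ¬Separated C u x x' := by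
  obtain ⟨V, hV⟩ := exists_event_set C L
  obtain ⟨E, hE⟩ := exists_event_edges C V
  have hVt : ∀ x y s, triple x y s ∈ V ↔ x ∈ L ∧ y ∈ L ∧ Event C x y s := by
    refine fun x y s => (hV _).trans ⟨?_, fun h => ⟨x, y, s, rfl, h⟩⟩
    rintro ⟨x', y', s', he, h⟩
    obtain ⟨rfl, rfl, rfl⟩ := triple_inj.1 he
    exact h
  have hEt : ∀ x y s x' y' s', npair (triple x y s) (triple x' y' s') ∈ E ↔
      triple x y s ∈ V ∧ triple x' y' s' ∈ V ∧ (Separated C s x x' ∨ Separated C s' x x') := by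
    refine fun x y s x' y' s' => (hE _).trans ⟨?_, fun h => ⟨x, y, s, x', y', s', rfl, h⟩⟩
    rintro ⟨a, b, c, a', b', c', he, h⟩
    obtain ⟨h1, h2⟩ := npair_inj.1 he
    obtain ⟨rfl, rfl, rfl⟩ := triple_inj.1 h1
    obtain ⟨rfl, rfl, rfl⟩ := triple_inj.1 h2
    exact h
  have hirr : ∀ s x, ¬Separated C s x x := fun s x hs => by
    obtain ⟨F, hF⟩ := hC.exists_colors s
    exact hs.2.2 F hF Iff.rfl
  have hG : IsGraph V E ∧ ¬Bdd V ∧ FinitelyColorable V E := by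
    refine ⟨⟨fun n hn => ?_, fun p q hpq => ?_, fun p hp => ?_⟩, ?_, ?_⟩
    · obtain ⟨x, y, s, x', y', s', rfl, hp, hq, -⟩ := (hE n).1 hn
      exact ⟨_, _, hp, hq, rfl⟩
    · obtain ⟨x, y, s, x', y', s', he, hp, hq, h⟩ := (hE _).1 hpq
      obtain ⟨rfl, rfl⟩ := npair_inj.1 he
      exact (hEt _ _ _ _ _ _).2 ⟨hq, hp, h.symm.imp Separated.symm Separated.symm⟩
    · obtain ⟨x, y, s, x', y', s', he, -, -, h⟩ := (hE _).1 hp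
      obtain ⟨h1, h2⟩ := npair_inj.1 he
      obtain ⟨rfl, -, -⟩ := triple_inj.1 (h1.symm.trans h2)
      exact h.elim (hirr _ _) (hirr _ _)
    · refine not_bdd_iff.2 fun b => ?_
      obtain ⟨x, hx, hbx⟩ := not_bdd_iff.1 hL b
      exact ⟨triple x x 0, (hVt _ _ _).2 ⟨hx, hx, .inl ⟨rfl, rfl⟩⟩, hbx.trans (left_le_npair _ _)⟩
    · rintro V₀ ⟨⟨b, hb⟩, -⟩
      obtain ⟨F, hF⟩ := hC.exists_colors b
      obtain ⟨G, hG⟩ := comprehension_D0 (P := fun n => ∃ x < n + 1, ∃ r < n + 1, n = npair x r ∧ x ∈ F)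
        (by repeat' constructor)
      have hGt : ∀ x y s, triple x y s ∈ G ↔ x ∈ F := by
        refine fun x y s => (hG _).trans ⟨?_, fun h => ⟨x, fst_lt_triple _ _ _, _,
          RCA.lt_add_one_iff.2 (right_le_npair _ _), rfl, h⟩⟩
        rintro ⟨x', -, r, -, he, h⟩
        rwa [(npair_inj.1 he).1]
      refine ⟨G, fun p q ⟨hp, hq, hpq⟩ => ?_⟩
      obtain ⟨x, y, s, x', y', s', he, -, -, h⟩ := (hE _).1 hpq
      obtain ⟨rfl, rfl⟩ := npair_inj.1 he
      rw [hGt, hGt]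
      have hstage : ∀ x y s, triple x y s ∈ V₀ → s ≤ b := fun x y s h =>
        (RCA.lt_add_one_iff.1 (trd_lt_triple x y s)).trans (hb _ h).le
      rcases h with h | h
      exacts [(h.mono (hstage _ _ _ hp)).2.2 F hF, (h.mono (hstage _ _ _ hq)).2.2 F hF]
  obtain ⟨H, hHV, hHb, hH⟩ := h V E hG
  refine ⟨H, hHb, fun n hn => (hV n).1 (hHV n hn), fun x y s x' y' s' hp hq u hu => ?_⟩
  obtain ⟨u, -, hu, hxx', hx'x⟩ := hu.exists_event
  have hpV := (hVt x y s).1 (hHV _ hp)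
  have hqV := (hVt x' y' s').1 (hHV _ hq)
  have h1 : triple x x' u ∈ V := (hVt _ _ _).2 ⟨hpV.1, hqV.1, hxx'⟩
  have h2 : triple x' x u ∈ V := (hVt _ _ _).2 ⟨hqV.1, hpV.1, hx'x⟩
  obtain ⟨V₀, hV₀⟩ := comprehension_D0 (P := fun n => n = triple x y s ∨ n = triple x' y' s' ∨
    n = triple x x' u ∨ n = triple x' x u) (by repeat' constructor)
  have hfin : Bdd V₀ ∧ ∀ n ∈ V₀, n ∈ V := by
    refine ⟨⟨triple x y s + triple x' y' s' + triple x x' u + triple x' x u + 1,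
      fun n hn => RCA.lt_add_one_iff.2 ?_⟩, fun n hn => ?_⟩
    · rcases (hV₀ n).1 hn with rfl | rfl | rfl | rfl
      · exact le_self_add.trans (le_self_add.trans le_self_add)
      · exact le_add_self.trans (le_self_add.trans le_self_add)
      · exact le_add_self.trans le_self_add
      · exact le_add_self
    · rcases (hV₀ n).1 hn with rfl | rfl | rfl | rfl
      exacts [hHV _ hp, hHV _ hq, h1, h2]
  obtain ⟨F, hF, hF'⟩ := hH V₀ hfin
  have e1 := hF _ _ ⟨(hV₀ _).2 (.inl rfl), (hV₀ _).2 (.inr (.inr (.inr rfl))),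
      (hEt x y s x' x u).2 ⟨hHV _ hp, h2, .inr hu⟩⟩
  have e2 := hF _ _ ⟨(hV₀ _).2 (.inr (.inr (.inl rfl))), (hV₀ _).2 (.inr (.inr (.inr rfl))),
      (hEt x x' u x' x u).2 ⟨h1, h2, .inr hu⟩⟩
  have e3 := hF _ _ ⟨(hV₀ _).2 (.inr (.inr (.inl rfl))), (hV₀ _).2 (.inr (.inl rfl)),
      (hEt x x' u x' y' s').2 ⟨h1, hHV _ hq, .inl hu⟩⟩
  have e4 := hF' _ ⟨(hV₀ _).2 (.inl rfl), hp⟩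
  have e5 := hF' _ ⟨(hV₀ _).2 (.inr (.inl rfl)), hq⟩
  tauto

theorem Rcolor.lrsat (h : Rcolor M) : Lrsat M := by
  rintro V C ⟨-, -, hC⟩ L ⟨-, hL⟩
  obtain ⟨K, hKb, hK, hKsep⟩ := h.exists_events hC hL
  have hirr : ∀ s x, ¬Separated C s x x := fun s x hs => by
    obtain ⟨F, hF⟩ := hC.exists_colors s
    exact hs.2.2 F hF Iff.rfl
  have hKt : ∀ x y s, triple x y s ∈ K → x ∈ L ∧ y ∈ L ∧ Event C x y s := fun x y s h => by
    obtain ⟨x', y', s', he, h⟩ := hK _ h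
    obtain ⟨rfl, rfl, rfl⟩ := triple_inj.1 he
    exact h
  by_cases hx : ∀ b, ∃ x, b ≤ x ∧ ∃ y s, triple x y s ∈ K
  · obtain ⟨H, hH, hHb⟩ := exists_unbounded_subset
      (E := fun x n => n ∈ K ∧ ∃ y < n + 1, ∃ s < n + 1, n = triple x y s) (by repeat' constructor)
      (by rintro x n ⟨-, y, -, s, -, rfl⟩; exact left_le_npair _ _)
      (fun b => (hx b).imp fun x ⟨hb, y, s, h⟩ => ⟨hb, triple x y s, h, y, snd_lt_triple _ _ _, s,
        trd_lt_triple _ _ _, rfl⟩)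
    refine ⟨H, fun x hxH => ?_, not_bdd_iff.2 hHb, homogeneousFml_of_not_separated hC
      fun u x hxH x' hxH' => ?_⟩
    · obtain ⟨_, h, y, -, s, -, rfl⟩ := hH x hxH
      exact (hKt _ _ _ h).1
    · obtain ⟨_, h, y, -, s, -, rfl⟩ := hH x hxH
      obtain ⟨_, h', y', -, s', -, rfl⟩ := hH x' hxH'
      exact hKsep _ _ _ _ _ _ h h' u
  · push Not at hx
    obtain ⟨c, hc⟩ := hx
    have hy : ∀ b, ∃ y, b ≤ y ∧ ∃ x s, triple x y s ∈ K ∧ Separated C s x y := by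
      intro b
      by_contra! hcon
      obtain ⟨D, hD⟩ := exists_separated_set C
      obtain ⟨B, hB⟩ := strong_collection
        (R := fun p s => ∃ x < p + 1, ∃ y < p + 1, p = npair x y ∧ triple x y s ∈ K ∧
          triple s x y ∈ D) (by repeat' constructor) (npair (c + b) (c + b) + 1)
      refine hKb ⟨triple c c 0 + triple (c + b) (c + b) B + 1, fun n hn => ?_⟩
      obtain ⟨x, y, s, rfl, -, -, hev⟩ := hK n hn
      have hxc : x < c := not_le.1 fun hcx => hc x hcx y s hn
      refine RCA.lt_add_one_iff.2 ?_
      rcases hev with ⟨rfl, rfl⟩ | ⟨hs, hmin⟩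
      · exact (npair_le_npair hxc.le (npair_le_npair hxc.le le_rfl)).trans le_self_add
      have hyb : y < b := not_le.1 fun hby => hcon y hby x s hn hs
      have hpair : npair x y ≤ npair (c + b) (c + b) :=
        npair_le_npair (hxc.le.trans le_self_add) (hyb.le.trans le_add_self)
      obtain ⟨s', hs', x', -, y', -, he, hn', hD'⟩ := hB _ (RCA.lt_add_one_iff.2 hpair) s
        ⟨x, RCA.lt_add_one_iff.2 (left_le_npair _ _), y, RCA.lt_add_one_iff.2 (right_le_npair _ _),
          rfl, hn, (hD _ _ _).2 hs⟩
      obtain ⟨rfl, rfl⟩ := npair_inj.1 he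
      have hss' : s ≤ s' := not_lt.1 fun hlt => hmin s' hlt ((hD _ _ _).1 hD')
      refine le_trans ?_ le_add_self
      exact npair_le_npair (hxc.le.trans le_self_add)
        (npair_le_npair (hyb.le.trans le_add_self) (hss'.trans hs'.le))
    obtain ⟨D, hD⟩ := exists_separated_set C
    obtain ⟨H, hH, hHb⟩ := exists_unbounded_subset
      (E := fun y n => n ∈ K ∧ ∃ x < n + 1, ∃ s < n + 1, n = triple x y s ∧ triple s x y ∈ D)
      (by repeat' constructor)
      (by
        rintro y n ⟨-, x, -, s, -, rfl, -⟩
        exact RCA.lt_add_one_iff.1 (snd_lt_triple _ _ _))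
      (fun b => (hy b).imp fun y ⟨hb, x, s, h, h'⟩ => ⟨hb, triple x y s, h, x, fst_lt_triple _ _ _, s,
        trd_lt_triple _ _ _, rfl, (hD _ _ _).2 h'⟩)
    simp only [hD] at hH
    refine ⟨H, fun x hxH => ?_, not_bdd_iff.2 hHb, homogeneousFml_of_not_separated hC
      fun u y hyH y' hyH' hsep => ?_⟩
    · obtain ⟨_, h, y, -, s, -, rfl, -⟩ := hH x hxH
      exact (hKt _ _ _ h).2.1
    · obtain ⟨_, h, x, -, s, -, rfl, hs⟩ := hH y hyH
      obtain ⟨_, h', x', -, s', -, rfl, hs'⟩ := hH y' hyH'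
      refine hKsep _ _ _ _ _ _ h h' (max u (max s s')) ?_
      exact (hs.mono ((le_max_left _ _).trans (le_max_right _ _))).trans
        (hsep.mono (le_max_left _ _))
        (hs'.symm.mono ((le_max_right _ _).trans (le_max_right _ _)))

end SOA

/-- `RCA₀` proves that `RCOLOR₂` is equivalent to `LRSAT([x ≠ y])`. -/
theorem theorem3p16 : SOA.Provable SOA.RCA0 (SOA.RCOLOR2 ⟷ SOA.LRSATneq) := by
  refine SOA.provable_of_valid fun M hM e s => ?_
  have : SOA.RCA M := ⟨hM⟩
  rw [SOA.Fml.sat_iff, SOA.sat_RCOLOR2, SOA.sat_LRSATneq]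
  exact ⟨SOA.Rcolor.lrsat, SOA.Lrsat.rcolor⟩
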